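/- Let $f_0,\rho_0\in C^\infty([0,1])$ satisfy $f_0(0)=f_0(1)=0$, $\rho_0(0)=\rho_0(1)=0$ and $\rho_0\ge 0$ on $[0,1]$. Suppose that $M_0:=\max_{[0,1]}f_0'>0$, that $f_0'$ attains the value $M_0$ only at boundary points $x_i^*\in\{0,1\}$, and that $f_0''(x_i^*)\neq 0$ at each such point (derivatives at $0$ and $1$ are one-sided). Consider the initial-boundary value problem $$f_{xt}+ff_{xx}-f_x^2+\rho=I(t),\qquad \rho_t+f\rho_x=\rho f_x,\qquad I(t)=\int_0^1\rho\,dx-2\int_0^1 f_x^2\,dx,$$ for $x\in[0,1]$, $t>0$, with $f(0,x)=f_0(x)$, $\rho(0,x)=\rho_0(x)$ and Dirichlet conditions $f(t,0)=f(t,1)=0$, $\rho(t,0)=\rho(t,1)=0$. A classical solution on $[0,T)$ is a pair $(f,\rho)$ for which $f,f_x,f_{xx},\rho,\rho_x$ exist and are continuous on $[0,T)\times[0,1]$, $f_{xt}$ and $\rho_t$ exist for $0<t<T$, and the equations, initial conditions and boundary conditions hold pointwise. Then there are a finite time $t^*>0$ and a classical solution $(f,\rho)$ on $[0,t^*)$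 such that every classical solution with the same data on an interval $[0,T)$ satisfies $T\le t^*$ and coincides with $(f,\rho)$ on $[0,T)\times[0,1]$, and such that, at each point $x_i^*$ where $f_0'$ attains $M_0$, $$\lim_{t\nearrow t^*}\int_0^t f_x(s,x_i^*)\,ds=+\infty,$$ and the vorticity $-y f_{xx}(t,x)$ of the velocity field $u=(f,-yf_x)$ on $[0,1]\times(0,\infty)$ blows up at $x_i^*$ at time $t^*$: for every $y>0$, $$\lim_{t\nearrow t^*}\left|-y f_{xx}(t,x_i^*)\right|=+\infty.$$ If moreover $f_0'$ attains $M_0$ at both endpoints, the blowup is two-sided: $$\lim_{t\nearrow t^*}f_{xx}(t,0)=-\infty,\qquad \lim_{t\nearrow t^*}f_{xx}(t,1)=+\infty .$$ -/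

import Mathlib

open Set Filter Topology

noncomputable section

namespace Boussinesq

/-- Spatial derivative on the closed interval `[0,1]` (one-sided at the two endpoints). -/
def dx (g : ℝ → ℝ) : ℝ → ℝ := fun x => derivWithin g (Icc 0 1) x

/-- The nonlocal term `I(t) = ∫₀¹ ρ dx - 2 ∫₀¹ f_x² dx`. -/
def nonlocalTerm (f ρ : ℝ → ℝ → ℝ) (t : ℝ) : ℝ :=
  (∫ x in (0 : ℝ)..1, ρ t x) - 2 * ∫ x in (0 : ℝ)..1, (dx (f t) x) ^ 2

/-- The vorticity `∇ × u = -y f_xx(t,x)` of the stagnation-point velocity field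
`u = (f(t,x), -y f_x(t,x))`. -/
def vorticity (f : ℝ → ℝ → ℝ) (t x y : ℝ) : ℝ := -y * dx (dx (f t)) x

/-- `(f, ρ)` is a classical solution on `[0,T) × [0,1]` of
`f_xt + f f_xx - f_x² + ρ = I(t)`, `ρ_t + f ρ_x = ρ f_x`
with initial data `(f₀, ρ₀)` and Dirichlet boundary conditions.
The functions `f, f_x, f_xx, ρ, ρ_x` are continuous on `[0,T) × [0,1]`, the time derivatives
`f_xt, ρ_t` exist for `0 < t < T` (their continuity follows from the equations), and the
equations hold pointwise. Values of `f t x`, `ρ t x` off `[0,T) × [0,1]` play no role. -/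
structure IsClassicalSolution (f₀ ρ₀ : ℝ → ℝ) (T : ℝ) (f ρ : ℝ → ℝ → ℝ) : Prop where
  contDiff_f : ∀ t ∈ Ico 0 T, ContDiffOn ℝ 2 (f t) (Icc 0 1)
  contDiff_rho : ∀ t ∈ Ico 0 T, ContDiffOn ℝ 1 (ρ t) (Icc 0 1)
  continuous_f : ContinuousOn (fun p : ℝ × ℝ => f p.1 p.2) (Ico 0 T ×ˢ Icc 0 1)
  continuous_fx : ContinuousOn (fun p : ℝ × ℝ => dx (f p.1) p.2) (Ico 0 T ×ˢ Icc 0 1)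
  continuous_fxx : ContinuousOn (fun p : ℝ × ℝ => dx (dx (f p.1)) p.2) (Ico 0 T ×ˢ Icc 0 1)
  continuous_rho : ContinuousOn (fun p : ℝ × ℝ => ρ p.1 p.2) (Ico 0 T ×ˢ Icc 0 1)
  continuous_rhox : ContinuousOn (fun p : ℝ × ℝ => dx (ρ p.1) p.2) (Ico 0 T ×ˢ Icc 0 1)
  differentiable_fx : ∀ t ∈ Ioo 0 T, ∀ x ∈ Icc (0 : ℝ) 1,
    DifferentiableAt ℝ (fun s => dx (f s) x) t
  differentiable_rho : ∀ t ∈ Ioo 0 T, ∀ x ∈ Icc (0 : ℝ) 1,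
    DifferentiableAt ℝ (fun s => ρ s x) t
  momentum : ∀ t ∈ Ioo 0 T, ∀ x ∈ Icc (0 : ℝ) 1,
    deriv (fun s => dx (f s) x) t + f t x * dx (dx (f t)) x - (dx (f t) x) ^ 2 + ρ t x
      = nonlocalTerm f ρ t
  temperature : ∀ t ∈ Ioo 0 T, ∀ x ∈ Icc (0 : ℝ) 1,
    deriv (fun s => ρ s x) t + f t x * dx (ρ t) x = ρ t x * dx (f t) x
  initial_f : ∀ x ∈ Icc (0 : ℝ) 1, f 0 x = f₀ x
  initial_rho : ∀ x ∈ Icc (0 : ℝ) 1, ρ 0 x = ρ₀ x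
  boundary_f : ∀ t ∈ Ico 0 T, f t 0 = 0 ∧ f t 1 = 0
  boundary_rho : ∀ t ∈ Ico 0 T, ρ t 0 = 0 ∧ ρ t 1 = 0

end Boussinesq

end

namespace Boussinesq

noncomputable section

open Function MeasureTheory
open scoped NNReal

/-! Write `h` for f₀', `r` for ρ₀, γ(t,·) for the flow map of f, and w = 1/γ_x. Along particle paths
f_x = -w_t/w and ρ = r/w, and the momentum equation becomes linear: w_tt + I(t) w = r, with w = 1
and w_t = -h at t = 0. The nonlocal coefficient I is determined by the constraint ∫₀¹ 1/w = 1, which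
says that γ fixes both endpoints.

Reduction of order leaves a single scalar unknown. In the stretched time η with dη/dt = P⁻², put w =
Pφ with φ = 1 - hη + r g(η). The equation holds for a suitable I as soon as g'' = P³ and g(0) =
g'(0) = 0, and the constraint forces P = ∫₀¹ 1/φ. What remains is the ODE g'' = (∫₀¹ (1 - hη + r
g)⁻¹)³. Its solution is nonnegative, so φ ≥ 1 - M₀η > 0 for 0 ≤ η < 1/M₀, and it exists up to η =
1/M₀ (`Admissible.exists_amplitude`). `Amplitude.lagrangianFlow` and
`LagrangianFlow.isClassicalSolution` lead back to a classical solution.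

Blowup is the limit η → 1/M₀. With ε = 1 - M₀η, the nondegenerate boundary maximum gives φ ≥ d(ε +
x(1-x)) (`exists_gap`), hence P ≤ C ε^(-1/4). Then t = ∫ P² dη stays bounded, so t* is finite
(`exists_time_change`), while at a maximum point w = Pε → 0. Since boundary particles do not move, ∫
f_x ds = -log w → +∞ there. At such a point f_xx equals (h' - r'(M₀ g + ε g'))/(Pε)
(`Amplitude.strainGrad_boundary`). At x = 0 one has h' < 0 ≤ r', at x = 1 the reverse, so the two
terms of the numerator never compete and f_xx tends to -∞ at 0 and to +∞ at 1.

Uniqueness is an L² energy estimate for the differences of f_x and ρ (`IsClassicalSolution.unique`).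
Maximality follows: a solution living beyond t* would have a bounded integral of f_x up to t*
(`IsClassicalSolution.lifespan_le`). -/

/-! ### Calculus with a parameter: primitives, inverses, moving points -/

theorem continuousOn_parametric_primitive {S : Set ℝ} {F : ℝ → ℝ → ℝ}
    (hF : ContinuousOn (uncurry F) (S ×ˢ univ)) (c : ℝ) :
    ContinuousOn (fun p : ℝ × ℝ => ∫ a in c..p.2, F p.1 a) (S ×ˢ univ) := by
  have h1 : Continuous (uncurry fun (p : S × ℝ) (a : ℝ) => F p.1 a) := by
    have : Continuous fun q : (S × ℝ) × ℝ => ((q.1.1 : ℝ), q.2) := by fun_prop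
    exact hF.comp_continuous this fun q => ⟨q.1.1.2, mem_univ _⟩
  have h2 := intervalIntegral.continuous_parametric_intervalIntegral_of_continuous
    (μ := volume) (a₀ := c) h1 (s := fun p : S × ℝ => p.2) (by fun_prop)
  rw [continuousOn_iff_continuous_domRestrict]
  have h3 : Continuous fun q : (S ×ˢ univ : Set (ℝ × ℝ)) =>
      ((⟨q.1.1, q.2.1⟩ : S), q.1.2) := by fun_prop
  exact h2.comp h3

theorem continuousOn_parametric_integral {S : Set ℝ} {F : ℝ → ℝ → ℝ} {c d : ℝ} (hcd : c ≤ d)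
    (hF : ContinuousOn (uncurry F) (S ×ˢ Icc c d)) :
    ContinuousOn (fun t => ∫ a in c..d, F t a) S := by
  have h1 : ContinuousOn (uncurry fun t a => F t (projIcc c d hcd a)) (S ×ˢ univ) := by
    have : Continuous fun q : ℝ × ℝ => (q.1, (projIcc c d hcd q.2 : ℝ)) := by fun_prop
    exact hF.comp this.continuousOn fun q hq => ⟨hq.1, Subtype.coe_prop _⟩
  have h2 := (continuousOn_parametric_primitive h1 c).comp
    (f := fun t : ℝ => (t, d)) (s := S) (by fun_prop) fun t ht => ⟨ht, mem_univ _⟩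
  refine h2.congr fun t _ => ?_
  refine intervalIntegral.integral_congr fun a ha => ?_
  rw [uIcc_of_le hcd] at ha
  simp [projIcc_of_mem hcd ha]

/-- Differentiation under the integral sign over a compact interval, with a jointly continuous
derivative. -/
theorem hasDerivAt_parametric_integral {S : Set ℝ} (hS : IsOpen S) {F F' : ℝ → ℝ → ℝ} {c d : ℝ}
    (hcd : c ≤ d) (hF : ∀ t ∈ S, ContinuousOn (F t) (Icc c d))
    (hF' : ContinuousOn (uncurry F') (S ×ˢ Icc c d))
    (hd : ∀ t ∈ S, ∀ a ∈ Icc c d, HasDerivAt (fun s => F s a) (F' t a) t) {t : ℝ} (ht : t ∈ S) :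
    HasDerivAt (fun s => ∫ a in c..d, F s a) (∫ a in c..d, F' t a) t := by
  obtain ⟨ε, hε, hb⟩ := Metric.nhds_basis_closedBall.mem_iff.1 (hS.mem_nhds ht)
  have hK : IsCompact (Metric.closedBall t ε ×ˢ Icc c d) :=
    (isCompact_closedBall t ε).prod isCompact_Icc
  obtain ⟨B, hB⟩ := hK.exists_bound_of_continuousOn (hF'.mono (prod_mono hb le_rfl))
  have hsub : uIoc c d ⊆ Icc c d := by
    rw [uIoc_of_le hcd]; exact Ioc_subset_Icc_self
  have hint : ∀ s ∈ S, IntervalIntegrable (F s) volume c d := fun s hs =>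
    ContinuousOn.intervalIntegrable (by rw [uIcc_of_le hcd]; exact hF s hs)
  have hF't : ContinuousOn (F' t) (Icc c d) :=
    hF'.comp (f := fun a => (t, a)) (by fun_prop) fun a ha => ⟨ht, ha⟩
  refine (intervalIntegral.hasDerivAt_integral_of_dominated_loc_of_deriv_le (F := F) (F' := F')
    (bound := fun _ => B) (Metric.closedBall_mem_nhds t hε) ?_ (hint t ht) ?_ ?_ ?_ ?_).2
  · filter_upwards [hS.mem_nhds ht] with s hs
    exact ((hF s hs).mono hsub).aestronglyMeasurable measurableSet_uIoc
  · exact (hF't.mono hsub).aestronglyMeasurable measurableSet_uIoc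
  · exact Eventually.of_forall fun a ha s hs => hB (s, a) ⟨hs, hsub ha⟩
  · exact intervalIntegrable_const
  · exact Eventually.of_forall fun a ha s hs => hd s (hb hs) a (hsub ha)

/-- A parametric primitive is jointly differentiable. -/
theorem hasFDerivAt_parametric_primitive {S : Set ℝ} (hS : IsOpen S) {F F' : ℝ → ℝ → ℝ}
    (hF : ContinuousOn (uncurry F) (S ×ˢ univ))
    (hF' : ContinuousOn (uncurry F') (S ×ˢ univ))
    (hd : ∀ t ∈ S, ∀ a, HasDerivAt (fun s => F s a) (F' t a) t) {t x c : ℝ} (ht : t ∈ S) :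
    HasFDerivAt (fun p : ℝ × ℝ => ∫ a in c..p.2, F p.1 a)
      ((ContinuousLinearMap.toSpanSingleton ℝ (∫ a in c..x, F' t a)).coprod
        (ContinuousLinearMap.toSpanSingleton ℝ (F t x))) (t, x) := by
  have hSn : S ×ˢ (univ : Set ℝ) ∈ 𝓝 (t, x) := (hS.prod isOpen_univ).mem_nhds ⟨ht, mem_univ _⟩
  have hslice : ∀ {G : ℝ → ℝ → ℝ}, ContinuousOn (uncurry G) (S ×ˢ univ) → ∀ s ∈ S,
      Continuous (G s) := fun hG s hs =>
    hG.comp_continuous (f := fun a => (s, a)) (by fun_prop) fun a => ⟨hs, mem_univ _⟩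
  have key := hasStrictFDerivAt_uncurry_coprod (𝕜 := ℝ) (u := (t, x))
    (f := fun s y => ∫ a in c..y, F s a)
    (f₁ := fun s y => ContinuousLinearMap.toSpanSingleton ℝ (∫ a in c..y, F' s a))
    (f₂ := fun s y => ContinuousLinearMap.toSpanSingleton ℝ (F s y)) ?_ ?_ ?_ ?_
  · exact key.hasFDerivAt
  · filter_upwards [hSn] with p hp
    have hp1 : p.1 ∈ S := hp.1
    refine HasDerivAt.hasFDerivAt ?_
    rcases le_total c p.2 with h | h
    · exact hasDerivAt_parametric_integral hS h (fun s hs => (hslice hF s hs).continuousOn)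
        (hF'.mono (prod_mono le_rfl (subset_univ _))) (fun s hs a _ => hd s hs a) hp1
    · have := hasDerivAt_parametric_integral hS h (fun s hs => (hslice hF s hs).continuousOn)
        (hF'.mono (prod_mono le_rfl (subset_univ _))) (fun s hs a _ => hd s hs a) hp1
      simp only [intervalIntegral.integral_symm p.2 c]
      exact this.neg
  · filter_upwards [hSn] with p hp
    have hp1 : p.1 ∈ S := hp.1
    exact ((hslice hF _ hp1).integral_hasStrictDerivAt c p.2).hasDerivAt.hasFDerivAt
  · exact (ContinuousLinearMap.toSpanSingletonCLE (𝕜 := ℝ) (E := ℝ)).continuous.continuousAt.comp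
      ((continuousOn_parametric_primitive hF' c).continuousAt hSn)
  · exact (ContinuousLinearMap.toSpanSingletonCLE (𝕜 := ℝ) (E := ℝ)).continuous.continuousAt.comp
      (hF.continuousAt hSn)

/-- The inverse of a continuous family of strictly increasing functions is jointly continuous. -/
theorem continuousOn_parametric_inverse {S U : Set ℝ} (hS : IsOpen S) {G X : ℝ → ℝ → ℝ}
    (hG : ContinuousOn (uncurry G) (S ×ˢ univ)) (hmono : ∀ t ∈ S, StrictMono (G t))
    (hX : ∀ t ∈ S, ∀ x ∈ U, G t (X t x) = x) :
    ContinuousOn (uncurry X) (S ×ˢ U) := by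
  rintro ⟨t, x⟩ ⟨ht, hx⟩
  simp only at ht hx
  have hGc : ∀ y, ContinuousWithinAt (fun p : ℝ × ℝ => G p.1 y) (S ×ˢ U) (t, x) := fun y => by
    have h1 : ContinuousAt (uncurry G) (t, y) :=
      hG.continuousAt ((hS.prod isOpen_univ).mem_nhds ⟨ht, mem_univ _⟩)
    have h2 : ContinuousAt (fun p : ℝ × ℝ => (p.1, y)) (t, x) := by fun_prop
    exact (ContinuousAt.comp (f := fun p : ℝ × ℝ => (p.1, y)) h1 h2).continuousWithinAt
  rw [ContinuousWithinAt, tendsto_order]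
  have hsnd : ContinuousWithinAt (fun p : ℝ × ℝ => p.2) (S ×ˢ U) (t, x) := by fun_prop
  constructor
  -- By monotonicity, a strict bound on X(t,x) by a fixed y amounts to a strict inequality between
  -- G(t,y) and x, which is an open condition in (t,x).
  · intro y hy
    have h1 : G t y < x := by
      conv_rhs => rw [← hX t ht x hx]
      exact hmono t ht hy
    filter_upwards [(hGc y).eventually_lt hsnd h1, self_mem_nhdsWithin] with p hp hpS
    by_contra hcon
    have := (hmono p.1 hpS.1).monotone (not_lt.1 hcon)
    rw [show uncurry X p = X p.1 p.2 from rfl, hX p.1 hpS.1 p.2 hpS.2] at this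
    exact absurd hp (not_lt.2 this)
  · intro y hy
    have h1 : x < G t y := by
      conv_lhs => rw [← hX t ht x hx]
      exact hmono t ht hy
    filter_upwards [hsnd.eventually_lt (hGc y) h1, self_mem_nhdsWithin] with p hp hpS
    by_contra hcon
    have := (hmono p.1 hpS.1).monotone (not_lt.1 hcon)
    rw [show uncurry X p = X p.1 p.2 from rfl, hX p.1 hpS.1 p.2 hpS.2] at this
    exact absurd hp (not_lt.2 this)

/-- Derivative in the parameter of an inverse function. -/
theorem hasDerivAt_parametric_inverse {G : ℝ × ℝ → ℝ} {Y : ℝ → ℝ} {t x g₁ g₂ : ℝ}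
    (hG : HasFDerivAt G ((ContinuousLinearMap.toSpanSingleton ℝ g₁).coprod
        (ContinuousLinearMap.toSpanSingleton ℝ g₂)) (t, Y t)) (hg₂ : g₂ ≠ 0)
    (hY : ContinuousAt Y t) (h : ∀ᶠ s in 𝓝 t, G (s, Y s) = x) :
    HasDerivAt Y (-g₁ / g₂) t := by
  -- The map (s,y) ↦ (s, G(s,y)) has an invertible derivative and carries (s, Y s) to (s, x). As Y
  -- is already known to be continuous, differentiability at this one point suffices, without the
  -- inverse function theorem.
  have hinv : LeftInverse
      ((ContinuousLinearMap.fst ℝ ℝ ℝ).prod ((ContinuousLinearMap.toSpanSingleton ℝ (-g₁ / g₂)).coprod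
        (ContinuousLinearMap.toSpanSingleton ℝ (1 / g₂))))
      ((ContinuousLinearMap.fst ℝ ℝ ℝ).prod ((ContinuousLinearMap.toSpanSingleton ℝ g₁).coprod
        (ContinuousLinearMap.toSpanSingleton ℝ g₂))) := by
    rintro ⟨u, v⟩
    ext <;> simp
    field_simp
    ring
  have h1 : HasFDerivAt (fun p : ℝ × ℝ => (p.1, G p)) _ (t, Y t) := hasFDerivAt_fst.prodMk hG
  have hh : HasFDerivAt (𝕜 := ℝ) (fun s : ℝ => (s, x)) _ t := (hasFDerivAt_id t).prodMk (hasFDerivAt_const x t)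
  have := HasFDerivAt.of_comp_of_leftInverse (g := fun s => (s, Y s))
    (by exact continuousAt_id.prodMk hY) h1 hh (by filter_upwards [h] with s hs; simp [hs]) hinv
  have h2 := (hasFDerivAt_snd.comp t this).hasDerivAt
  convert! h2 using 1
  simp

/-- Chain rule along a curve staying in a set on which only the one-sided derivative is known. -/
theorem hasDerivAt_along_curve {F F' : ℝ → ℝ → ℝ} {Y : ℝ → ℝ} {U : Set ℝ} {t y' Fx : ℝ}
    (hd : ∀ᶠ s in 𝓝 t, ∀ y ∈ U, HasDerivAt (fun s => F s y) (F' s y) s)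
    (hc : ContinuousWithinAt (uncurry F') (univ ×ˢ U) (t, Y t))
    (hx : HasDerivWithinAt (F t) Fx U (Y t)) (hY : HasDerivAt Y y' t)
    (hU : ∀ᶠ s in 𝓝 t, Y s ∈ U) :
    HasDerivAt (fun s => F s (Y s)) (F' t (Y t) + Fx * y') t := by
  have h2 : HasDerivAt (fun s => F t (Y s)) (Fx * y') t := hx.comp_hasDerivAt t hY hU
  -- Only a derivative within U is available in space, so time and space increments are separated.
  -- The time increment is taken at the frozen point Y s and handled by the mean value inequality,
  -- with F' within ε of its value at (t, Y t).
  have h1 : HasDerivAt (fun s => F s (Y s) - F t (Y s)) (F' t (Y t)) t := by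
    rw [hasDerivAt_iff_isLittleO, Asymptotics.isLittleO_iff]
    intro ε hε
    have hev : ∀ᶠ p in 𝓝[univ ×ˢ U] (t, Y t), dist (F' p.1 p.2) (F' t (Y t)) < ε :=
      Metric.tendsto_nhds.1 hc ε hε
    rw [nhdsWithin_prod_eq, nhdsWithin_univ] at hev
    obtain ⟨pa, hpa, pb, hpb, hab⟩ := Filter.eventually_prod_iff.1 hev
    have hYt : Tendsto Y (𝓝 t) (𝓝[U] (Y t)) :=
      tendsto_nhdsWithin_iff.2 ⟨hY.continuousAt, hU⟩
    obtain ⟨δ, hδ, hball⟩ := Metric.eventually_nhds_iff_ball.1 (hpa.and hd)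
    filter_upwards [hYt.eventually hpb, hU, Metric.ball_mem_nhds t hδ] with s hs hsU hsb
    have key := (convex_ball t δ).norm_image_sub_le_of_norm_hasDerivWithin_le
      (f := fun σ => F σ (Y s) - σ * F' t (Y t))
      (f' := fun σ => F' σ (Y s) - 1 * F' t (Y t)) (C := ε)
      (fun σ hσ => (((hball σ hσ).2 (Y s) hsU).sub
        ((hasDerivAt_id σ).mul_const _)).hasDerivWithinAt)
      (fun σ hσ => by
        have := hab (hball σ hσ).1 hs
        rw [Real.dist_eq] at this
        simpa using this.le)
      (Metric.mem_ball_self hδ) hsb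
    have e : F s (Y s) - F t (Y s) - (F t (Y t) - F t (Y t)) - (s - t) • F' t (Y t)
      = F s (Y s) - s * F' t (Y t) - (F t (Y s) - t * F' t (Y t)) := by
      simp only [smul_eq_mul]; ring
    rw [e]; exact key
  exact (h1.fun_add h2).congr_of_eventuallyEq (Eventually.of_forall fun s => by simp)

/-! ### Regularity on the closed unit interval -/

theorem contDiffOn_one_of_hasDerivWithinAt {g g' : ℝ → ℝ}
    (h : ∀ x ∈ Icc (0 : ℝ) 1, HasDerivWithinAt g (g' x) (Icc 0 1) x)
    (hc : ContinuousOn g' (Icc 0 1)) : ContDiffOn ℝ 1 g (Icc 0 1) := by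
  have hu : UniqueDiffOn ℝ (Icc (0 : ℝ) 1) := uniqueDiffOn_Icc zero_lt_one
  rw [contDiffOn_one_iff_derivWithin hu]
  exact ⟨fun x hx => (h x hx).differentiableWithinAt,
    hc.congr fun x hx => (h x hx).derivWithin (hu x hx)⟩

theorem contDiffOn_two_of_hasDerivWithinAt {g g' g'' : ℝ → ℝ}
    (h : ∀ x ∈ Icc (0 : ℝ) 1, HasDerivWithinAt g (g' x) (Icc 0 1) x)
    (h' : ∀ x ∈ Icc (0 : ℝ) 1, HasDerivWithinAt g' (g'' x) (Icc 0 1) x)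
    (hc : ContinuousOn g'' (Icc 0 1)) : ContDiffOn ℝ 2 g (Icc 0 1) := by
  have hu : UniqueDiffOn ℝ (Icc (0 : ℝ) 1) := uniqueDiffOn_Icc zero_lt_one
  rw [show (2 : WithTop ℕ∞) = 1 + 1 by norm_num, contDiffOn_succ_iff_derivWithin hu]
  refine ⟨fun x hx => (h x hx).differentiableWithinAt, by simp, ?_⟩
  exact (contDiffOn_one_of_hasDerivWithinAt h' hc).congr fun x hx =>
    (h x hx).derivWithin (hu x hx)

theorem dx_eq {g : ℝ → ℝ} {g' x : ℝ} (hx : x ∈ Icc (0 : ℝ) 1)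
    (h : HasDerivWithinAt g g' (Icc 0 1) x) : dx g x = g' :=
  h.derivWithin (uniqueDiffOn_Icc zero_lt_one x hx)

theorem dx_congr {g k : ℝ → ℝ} (h : ∀ x ∈ Icc (0 : ℝ) 1, g x = k x) {x : ℝ}
    (hx : x ∈ Icc (0 : ℝ) 1) : dx g x = dx k x :=
  derivWithin_congr h (h x hx)

theorem continuous_slice {G : ℝ → ℝ → ℝ} {S : Set ℝ} (hG : ContinuousOn (uncurry G) (S ×ˢ univ)) {t : ℝ}
    (ht : t ∈ S) : Continuous (G t) :=
  hG.comp_continuous (f := fun a => (t, a)) (by fun_prop) fun _ => ⟨ht, mem_univ _⟩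

theorem continuousOn_slice {F : ℝ → ℝ → ℝ} {S : Set ℝ}
    (hF : ContinuousOn (fun p : ℝ × ℝ => F p.1 p.2) (S ×ˢ Icc (0 : ℝ) 1)) {t : ℝ} (ht : t ∈ S) :
    ContinuousOn (F t) (Icc 0 1) :=
  hF.comp (f := fun a => (t, a)) (by fun_prop) fun _ hx => ⟨ht, hx⟩

theorem intervalIntegrable_of_Icc {g : ℝ → ℝ} (hg : ContinuousOn g (Icc (0 : ℝ) 1)) :
    IntervalIntegrable g volume 0 1 :=
  ContinuousOn.intervalIntegrable (by rwa [uIcc_of_le zero_le_one])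

/-! ### Lagrangian flow and the return to Eulerian variables -/

/-- The Lagrangian form of the problem: `w` is the reciprocal of the Jacobian of the flow, and
solves the linear equation `w_tt + c(t) w = r(x)`, where `c` is determined by the constraint that
the Jacobian has mean one. -/
structure LagrangianFlow (h r r' : ℝ → ℝ) (a b : ℝ) (w wt wx wtx : ℝ → ℝ → ℝ) (c : ℝ → ℝ) :
    Prop where
  zero_mem : (0 : ℝ) ∈ Ioo a b
  cont_r : Continuous r
  deriv_r : ∀ x ∈ Icc (0 : ℝ) 1, HasDerivWithinAt r (r' x) (Icc 0 1) x
  cont_r' : ContinuousOn r' (Icc 0 1)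
  r_zero : r 0 = 0
  r_one : r 1 = 0
  cont_w : ContinuousOn (uncurry w) (Ioo a b ×ˢ univ)
  cont_wt : ContinuousOn (uncurry wt) (Ioo a b ×ˢ univ)
  cont_wx : ContinuousOn (uncurry wx) (Ioo a b ×ˢ Icc 0 1)
  cont_wtx : ContinuousOn (uncurry wtx) (Ioo a b ×ˢ Icc 0 1)
  cont_c : ContinuousOn c (Ioo a b)
  pos : ∀ t ∈ Ioo a b, ∀ x, 0 < w t x
  bdd : ∀ t ∈ Ioo a b, ∃ B, ∀ x, w t x ≤ B
  deriv_w : ∀ t ∈ Ioo a b, ∀ x, HasDerivAt (fun s => w s x) (wt t x) t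
  deriv_wt : ∀ t ∈ Ioo a b, ∀ x, HasDerivAt (fun s => wt s x) (r x - c t * w t x) t
  deriv_wx : ∀ t ∈ Ioo a b, ∀ x ∈ Icc (0 : ℝ) 1, HasDerivWithinAt (w t) (wx t x) (Icc 0 1) x
  deriv_wtx : ∀ t ∈ Ioo a b, ∀ x ∈ Icc (0 : ℝ) 1, HasDerivWithinAt (wt t) (wtx t x) (Icc 0 1) x
  mean : ∀ t ∈ Ioo a b, ∫ x in (0 : ℝ)..1, (w t x)⁻¹ = 1
  init_w : ∀ x, w 0 x = 1
  init_wt : ∀ x, wt 0 x = -h x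

/-- The particle trajectories. -/
def flowMap (w : ℝ → ℝ → ℝ) (t x : ℝ) : ℝ := ∫ a in (0 : ℝ)..x, (w t a)⁻¹

/-- The back-to-labels map. -/
def labelMap (w : ℝ → ℝ → ℝ) (t x : ℝ) : ℝ := invFun (flowMap w t) x

/-- The Eulerian velocity. -/
def velocity (w wt : ℝ → ℝ → ℝ) (t x : ℝ) : ℝ :=
  ∫ a in (0 : ℝ)..labelMap w t x, -wt t a / w t a ^ 2

/-- The Eulerian velocity gradient. -/
def strain (w wt : ℝ → ℝ → ℝ) (t x : ℝ) : ℝ :=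
  -wt t (labelMap w t x) / w t (labelMap w t x)

/-- The Eulerian temperature. -/
def temp (r : ℝ → ℝ) (w : ℝ → ℝ → ℝ) (t x : ℝ) : ℝ :=
  r (labelMap w t x) / w t (labelMap w t x)

/-- The second derivative of the velocity. -/
def strainGrad (w wt wx wtx : ℝ → ℝ → ℝ) (t x : ℝ) : ℝ :=
  wt t (labelMap w t x) * wx t (labelMap w t x) / w t (labelMap w t x) - wtx t (labelMap w t x)

/-- The derivative of the temperature. -/
def tempGrad (r r' : ℝ → ℝ) (w wx : ℝ → ℝ → ℝ) (t x : ℝ) : ℝ :=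
  r' (labelMap w t x) - r (labelMap w t x) * wx t (labelMap w t x) / w t (labelMap w t x)

namespace LagrangianFlow

variable {h r r' : ℝ → ℝ} {a b : ℝ} {w wt wx wtx : ℝ → ℝ → ℝ} {c : ℝ → ℝ}

theorem cont_inv (L : LagrangianFlow h r r' a b w wt wx wtx c) :
    ContinuousOn (uncurry fun t x => (w t x)⁻¹) (Ioo a b ×ˢ univ) :=
  L.cont_w.inv₀ fun p hp => (L.pos p.1 hp.1 p.2).ne'

theorem cont_density (L : LagrangianFlow h r r' a b w wt wx wtx c) :
    ContinuousOn (uncurry fun t x => -wt t x / w t x ^ 2) (Ioo a b ×ˢ univ) :=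
  L.cont_wt.neg.div (L.cont_w.pow 2) fun p hp => (pow_pos (L.pos p.1 hp.1 p.2) 2).ne'

theorem hasDerivAt_flowMap (L : LagrangianFlow h r r' a b w wt wx wtx c) {t : ℝ}
    (ht : t ∈ Ioo a b) (x : ℝ) : HasDerivAt (flowMap w t) (w t x)⁻¹ x :=
  ((continuous_slice L.cont_inv ht).integral_hasStrictDerivAt 0 x).hasDerivAt

theorem strictMono_flowMap (L : LagrangianFlow h r r' a b w wt wx wtx c) {t : ℝ}
    (ht : t ∈ Ioo a b) : StrictMono (flowMap w t) :=
  strictMono_of_hasDerivAt_pos (L.hasDerivAt_flowMap ht) fun x => inv_pos.2 (L.pos t ht x)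

theorem flowMap_zero (t : ℝ) : flowMap w t 0 = 0 := by simp [flowMap]

theorem surjective_flowMap (L : LagrangianFlow h r r' a b w wt wx wtx c) {t : ℝ}
    (ht : t ∈ Ioo a b) : Surjective (flowMap w t) := by
  obtain ⟨B, hB⟩ := L.bdd t ht
  have hBpos : 0 < B := (L.pos t ht 0).trans_le (hB 0)
  -- An upper bound B for w bounds the slope of the flow map below by 1/B, so it grows at least
  -- linearly in both directions.
  have hd : ∀ x, HasDerivAt (fun x => flowMap w t x - x * B⁻¹) ((w t x)⁻¹ - 1 * B⁻¹) x := fun x =>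
    (L.hasDerivAt_flowMap ht x).sub ((hasDerivAt_id x).mul_const _)
  have hmono : Monotone fun x => flowMap w t x - x * B⁻¹ :=
    monotone_of_hasDerivAt_nonneg hd fun x => by
      have := inv_anti₀ (L.pos t ht x) (hB x)
      simp only [Pi.zero_apply]
      linarith
  have hcont : Continuous (flowMap w t) :=
    continuous_iff_continuousAt.2 fun x => (L.hasDerivAt_flowMap ht x).continuousAt
  have hBi : 0 < B⁻¹ := inv_pos.2 hBpos
  refine hcont.surjective ?_ ?_
  · refine tendsto_atTop_mono' atTop ?_ (tendsto_id.atTop_mul_const hBi)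
    filter_upwards [eventually_ge_atTop 0] with x hx
    have := hmono hx
    simp only [flowMap_zero, id] at this ⊢
    linarith
  · refine tendsto_atBot_mono' atBot ?_ (tendsto_id.atBot_mul_const hBi)
    filter_upwards [eventually_le_atBot 0] with x hx
    have := hmono hx
    simp only [flowMap_zero, id] at this ⊢
    linarith

theorem flowMap_labelMap (L : LagrangianFlow h r r' a b w wt wx wtx c) {t : ℝ}
    (ht : t ∈ Ioo a b) (x : ℝ) : flowMap w t (labelMap w t x) = x :=
  rightInverse_invFun (L.surjective_flowMap ht) x

theorem labelMap_flowMap (L : LagrangianFlow h r r' a b w wt wx wtx c) {t : ℝ}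
    (ht : t ∈ Ioo a b) (x : ℝ) : labelMap w t (flowMap w t x) = x :=
  leftInverse_invFun (L.strictMono_flowMap ht).injective x

theorem labelMap_zero (L : LagrangianFlow h r r' a b w wt wx wtx c) {t : ℝ}
    (ht : t ∈ Ioo a b) : labelMap w t 0 = 0 := by
  simpa [flowMap_zero] using L.labelMap_flowMap ht 0

theorem labelMap_one (L : LagrangianFlow h r r' a b w wt wx wtx c) {t : ℝ}
    (ht : t ∈ Ioo a b) : labelMap w t 1 = 1 := by
  have := L.labelMap_flowMap ht 1
  rwa [show flowMap w t 1 = 1 from L.mean t ht] at this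

theorem monotone_labelMap (L : LagrangianFlow h r r' a b w wt wx wtx c) {t : ℝ}
    (ht : t ∈ Ioo a b) : Monotone (labelMap w t) := fun x y hxy => by
  rw [← (L.strictMono_flowMap ht).le_iff_le, L.flowMap_labelMap ht, L.flowMap_labelMap ht]
  exact hxy

theorem labelMap_mem (L : LagrangianFlow h r r' a b w wt wx wtx c) {t : ℝ}
    (ht : t ∈ Ioo a b) {x : ℝ} (hx : x ∈ Icc (0 : ℝ) 1) : labelMap w t x ∈ Icc (0 : ℝ) 1 := by
  have h0 := L.monotone_labelMap ht hx.1
  have h1 := L.monotone_labelMap ht hx.2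
  rw [L.labelMap_zero ht] at h0
  rw [L.labelMap_one ht] at h1
  exact ⟨h0, h1⟩

theorem cont_labelMap (L : LagrangianFlow h r r' a b w wt wx wtx c) :
    ContinuousOn (uncurry (labelMap w)) (Ioo a b ×ˢ univ) :=
  continuousOn_parametric_inverse (G := flowMap w) isOpen_Ioo
    (continuousOn_parametric_primitive L.cont_inv 0) (fun _ ht => L.strictMono_flowMap ht)
    fun _ ht x _ => L.flowMap_labelMap ht x

theorem hasDerivAt_labelMap (L : LagrangianFlow h r r' a b w wt wx wtx c) {t : ℝ}
    (ht : t ∈ Ioo a b) (x : ℝ) : HasDerivAt (labelMap w t) (w t (labelMap w t x)) x := by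
  have := HasDerivAt.of_local_left_inverse (g := labelMap w t)
    (continuous_slice L.cont_labelMap ht).continuousAt (L.hasDerivAt_flowMap ht (labelMap w t x))
    (inv_ne_zero (L.pos t ht _).ne') (Eventually.of_forall (L.flowMap_labelMap ht))
  rwa [inv_inv] at this

/-- Implicit differentiation of γ(t, label) = x: the time derivative is -γ_t/γ_x, where γ_t at the
label is the velocity and 1/γ_x = w. -/
theorem hasDerivAt_labelMap_time (L : LagrangianFlow h r r' a b w wt wx wtx c) {t : ℝ}
    (ht : t ∈ Ioo a b) (x : ℝ) :
    HasDerivAt (fun s => labelMap w s x) (-velocity w wt t x * w t (labelMap w t x)) t := by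
  have hS : IsOpen (Ioo a b) := isOpen_Ioo
  have hinv : ∀ s ∈ Ioo a b, ∀ y, HasDerivAt (fun s => (w s y)⁻¹) (-wt s y / w s y ^ 2) s :=
    fun s hs y => (L.deriv_w s hs y).inv (L.pos s hs y).ne'
  have h1 := hasFDerivAt_parametric_primitive hS L.cont_inv L.cont_density hinv
    (x := labelMap w t x) (c := 0) ht
  have hY : ContinuousAt (fun s => labelMap w s x) t := by
    have h2 : ContinuousAt (uncurry (labelMap w)) (t, x) :=
      L.cont_labelMap.continuousAt ((hS.prod isOpen_univ).mem_nhds ⟨ht, mem_univ _⟩)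
    exact ContinuousAt.comp (f := fun s : ℝ => (s, x)) h2 (by fun_prop)
  have h3 := hasDerivAt_parametric_inverse h1 (inv_ne_zero (L.pos t ht _).ne') hY (x := x) (by
    filter_upwards [hS.mem_nhds ht] with s hs
    exact L.flowMap_labelMap hs x)
  rwa [div_inv_eq_mul] at h3

theorem hasDerivAt_velocity (L : LagrangianFlow h r r' a b w wt wx wtx c) {t : ℝ}
    (ht : t ∈ Ioo a b) (x : ℝ) : HasDerivAt (velocity w wt t) (strain w wt t x) x := by
  have h1 := ((continuous_slice L.cont_density ht).integral_hasStrictDerivAt 0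
    (labelMap w t x)).hasDerivAt.comp x (L.hasDerivAt_labelMap ht x)
  convert! h1 using 1
  have := (L.pos t ht (labelMap w t x)).ne'
  rw [strain]
  field_simp

theorem hasDerivWithinAt_comp_labelMap (L : LagrangianFlow h r r' a b w wt wx wtx c) {t : ℝ}
    (ht : t ∈ Ioo a b) {x : ℝ} {g : ℝ → ℝ} {g' : ℝ}
    (hg : HasDerivWithinAt g g' (Icc 0 1) (labelMap w t x)) :
    HasDerivWithinAt (fun y => g (labelMap w t y)) (g' * w t (labelMap w t x)) (Icc 0 1) x :=
  hg.comp x (L.hasDerivAt_labelMap ht x).hasDerivWithinAt fun _ hy => L.labelMap_mem ht hy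

theorem hasDerivWithinAt_strain (L : LagrangianFlow h r r' a b w wt wx wtx c) {t : ℝ}
    (ht : t ∈ Ioo a b) {x : ℝ} (hx : x ∈ Icc (0 : ℝ) 1) :
    HasDerivWithinAt (strain w wt t) (strainGrad w wt wx wtx t x) (Icc 0 1) x := by
  have hm := L.labelMap_mem ht hx
  have hw := (L.pos t ht (labelMap w t x)).ne'
  have h1 := (L.hasDerivWithinAt_comp_labelMap ht (L.deriv_wtx t ht _ hm)).fun_neg.div
    (L.hasDerivWithinAt_comp_labelMap ht (L.deriv_wx t ht _ hm)) hw
  refine h1.congr_deriv ?_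
  rw [strainGrad]
  field_simp
  ring

theorem hasDerivWithinAt_temp (L : LagrangianFlow h r r' a b w wt wx wtx c) {t : ℝ}
    (ht : t ∈ Ioo a b) {x : ℝ} (hx : x ∈ Icc (0 : ℝ) 1) :
    HasDerivWithinAt (temp r w t) (tempGrad r r' w wx t x) (Icc 0 1) x := by
  have hm := L.labelMap_mem ht hx
  have hw := (L.pos t ht (labelMap w t x)).ne'
  have h1 := (L.hasDerivWithinAt_comp_labelMap ht (L.deriv_r _ hm)).div
    (L.hasDerivWithinAt_comp_labelMap ht (L.deriv_wx t ht _ hm)) hw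
  refine h1.congr_deriv ?_
  rw [tempGrad]
  field_simp

theorem hasDerivAt_along_labelMap (L : LagrangianFlow h r r' a b w wt wx wtx c) {t : ℝ}
    (ht : t ∈ Ioo a b) {x : ℝ} (hx : x ∈ Icc (0 : ℝ) 1) {F F' : ℝ → ℝ → ℝ} {Fx : ℝ}
    (hd : ∀ s ∈ Ioo a b, ∀ y, HasDerivAt (fun s => F s y) (F' s y) s)
    (hc : ContinuousOn (uncurry F') (Ioo a b ×ˢ univ))
    (hFx : HasDerivWithinAt (F t) Fx (Icc 0 1) (labelMap w t x)) :
    HasDerivAt (fun s => F s (labelMap w s x))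
      (F' t (labelMap w t x) + Fx * (-velocity w wt t x * w t (labelMap w t x))) t := by
  have hS : Ioo a b ∈ 𝓝 t := isOpen_Ioo.mem_nhds ht
  refine hasDerivAt_along_curve (U := Icc 0 1) ?_ ?_ hFx (L.hasDerivAt_labelMap_time ht x) ?_
  · filter_upwards [hS] with s hs y _ using hd s hs y
  · exact (hc.continuousAt (prod_mem_nhds hS univ_mem)).continuousWithinAt
  · filter_upwards [hS] with s hs using L.labelMap_mem hs hx

/-- The material derivative of -w_t/w is computed from w_tt = r - c w; the motion of the label
contributes the advection term. This is the momentum equation with `c t` in the place of the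
nonlocal term. -/
theorem hasDerivAt_strain_time (L : LagrangianFlow h r r' a b w wt wx wtx c) {t : ℝ}
    (ht : t ∈ Ioo a b) {x : ℝ} (hx : x ∈ Icc (0 : ℝ) 1) :
    HasDerivAt (fun s => strain w wt s x)
      (c t - velocity w wt t x * strainGrad w wt wx wtx t x + strain w wt t x ^ 2
        - temp r w t x) t := by
  have hm := L.labelMap_mem ht hx
  have hw := (L.pos t ht (labelMap w t x)).ne'
  have hcont : ContinuousOn (uncurry fun t x => r x - c t * w t x) (Ioo a b ×ˢ univ) :=
    (L.cont_r.comp_continuousOn continuousOn_snd).sub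
      ((L.cont_c.comp continuousOn_fst fun p hp => hp.1).mul L.cont_w)
  have h1 := L.hasDerivAt_along_labelMap ht hx L.deriv_w L.cont_wt (L.deriv_wx t ht _ hm)
  have h2 := L.hasDerivAt_along_labelMap ht hx L.deriv_wt hcont (L.deriv_wtx t ht _ hm)
  refine (h2.fun_neg.div h1 hw).congr_deriv ?_
  rw [strainGrad, strain, temp]
  field_simp
  ring

theorem hasDerivAt_temp_time (L : LagrangianFlow h r r' a b w wt wx wtx c) {t : ℝ}
    (ht : t ∈ Ioo a b) {x : ℝ} (hx : x ∈ Icc (0 : ℝ) 1) :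
    HasDerivAt (fun s => temp r w s x)
      (temp r w t x * strain w wt t x - velocity w wt t x * tempGrad r r' w wx t x) t := by
  have hm := L.labelMap_mem ht hx
  have hw := (L.pos t ht (labelMap w t x)).ne'
  have h1 := L.hasDerivAt_along_labelMap ht hx L.deriv_w L.cont_wt (L.deriv_wx t ht _ hm)
  have h2 := L.hasDerivAt_along_labelMap ht hx (F := fun _ => r) (F' := fun _ _ => 0)
    (fun s _ y => hasDerivAt_const s (r y)) continuousOn_const (L.deriv_r _ hm)
  refine (h2.div h1 hw).congr_deriv ?_
  rw [tempGrad, strain, temp]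
  field_simp
  ring

theorem cont_comp_labelMap (L : LagrangianFlow h r r' a b w wt wx wtx c) {F : ℝ → ℝ → ℝ}
    (hF : ContinuousOn (uncurry F) (Ioo a b ×ˢ Icc 0 1)) :
    ContinuousOn (fun p : ℝ × ℝ => F p.1 (labelMap w p.1 p.2)) (Ioo a b ×ˢ Icc 0 1) := by
  have h1 : ContinuousOn (fun p : ℝ × ℝ => (p.1, labelMap w p.1 p.2)) (Ioo a b ×ˢ Icc 0 1) :=
    continuousOn_fst.prodMk (L.cont_labelMap.mono (prod_mono le_rfl (subset_univ _)))
  exact hF.comp h1 fun p hp => ⟨hp.1, L.labelMap_mem hp.1 hp.2⟩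

theorem cont_velocity (L : LagrangianFlow h r r' a b w wt wx wtx c) :
    ContinuousOn (fun p : ℝ × ℝ => velocity w wt p.1 p.2) (Ioo a b ×ˢ Icc 0 1) :=
  L.cont_comp_labelMap (F := fun t y => ∫ a in (0 : ℝ)..y, -wt t a / w t a ^ 2)
    ((continuousOn_parametric_primitive L.cont_density 0).mono
      (prod_mono le_rfl (subset_univ _)))

theorem ne_zero_labelMap (L : LagrangianFlow h r r' a b w wt wx wtx c) :
    ∀ p ∈ Ioo a b ×ˢ Icc (0 : ℝ) 1, w p.1 (labelMap w p.1 p.2) ≠ 0 :=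
  fun p hp => (L.pos p.1 hp.1 _).ne'

theorem cont_w_labelMap (L : LagrangianFlow h r r' a b w wt wx wtx c) :
    ContinuousOn (fun p : ℝ × ℝ => w p.1 (labelMap w p.1 p.2)) (Ioo a b ×ˢ Icc 0 1) :=
  L.cont_comp_labelMap (L.cont_w.mono (prod_mono le_rfl (subset_univ _)))

theorem cont_wt_labelMap (L : LagrangianFlow h r r' a b w wt wx wtx c) :
    ContinuousOn (fun p : ℝ × ℝ => wt p.1 (labelMap w p.1 p.2)) (Ioo a b ×ˢ Icc 0 1) :=
  L.cont_comp_labelMap (L.cont_wt.mono (prod_mono le_rfl (subset_univ _)))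

theorem cont_r_labelMap (L : LagrangianFlow h r r' a b w wt wx wtx c) :
    ContinuousOn (fun p : ℝ × ℝ => r (labelMap w p.1 p.2)) (Ioo a b ×ˢ Icc 0 1) :=
  L.cont_comp_labelMap (F := fun _ => r) (L.cont_r.comp continuous_snd).continuousOn

theorem cont_strain (L : LagrangianFlow h r r' a b w wt wx wtx c) :
    ContinuousOn (fun p : ℝ × ℝ => strain w wt p.1 p.2) (Ioo a b ×ˢ Icc 0 1) :=
  L.cont_wt_labelMap.neg.div L.cont_w_labelMap L.ne_zero_labelMap

theorem cont_strainGrad (L : LagrangianFlow h r r' a b w wt wx wtx c) :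
    ContinuousOn (fun p : ℝ × ℝ => strainGrad w wt wx wtx p.1 p.2) (Ioo a b ×ˢ Icc 0 1) :=
  ((L.cont_wt_labelMap.mul (L.cont_comp_labelMap L.cont_wx)).div L.cont_w_labelMap
    L.ne_zero_labelMap).sub (L.cont_comp_labelMap L.cont_wtx)

theorem cont_temp (L : LagrangianFlow h r r' a b w wt wx wtx c) :
    ContinuousOn (fun p : ℝ × ℝ => temp r w p.1 p.2) (Ioo a b ×ˢ Icc 0 1) :=
  L.cont_r_labelMap.div L.cont_w_labelMap L.ne_zero_labelMap

theorem cont_tempGrad (L : LagrangianFlow h r r' a b w wt wx wtx c) :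
    ContinuousOn (fun p : ℝ × ℝ => tempGrad r r' w wx p.1 p.2) (Ioo a b ×ˢ Icc 0 1) := by
  have h1 : ContinuousOn (uncurry fun _ : ℝ => r') (Ioo a b ×ˢ Icc 0 1) :=
    L.cont_r'.comp continuousOn_snd fun p hp => hp.2
  exact (L.cont_comp_labelMap h1).sub ((L.cont_r_labelMap.mul
    (L.cont_comp_labelMap L.cont_wx)).div L.cont_w_labelMap L.ne_zero_labelMap)

theorem velocity_zero (L : LagrangianFlow h r r' a b w wt wx wtx c) {t : ℝ}
    (ht : t ∈ Ioo a b) : velocity w wt t 0 = 0 := by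
  simp [velocity, L.labelMap_zero ht]

/-- Differentiate the constraint ∫₀¹ 1/w = 1 in time. -/
theorem velocity_one (L : LagrangianFlow h r r' a b w wt wx wtx c) {t : ℝ}
    (ht : t ∈ Ioo a b) : velocity w wt t 1 = 0 := by
  have h1 := hasDerivAt_parametric_integral isOpen_Ioo zero_le_one
    (fun s hs => (continuous_slice L.cont_inv hs).continuousOn)
    (L.cont_density.mono (prod_mono le_rfl (subset_univ (Icc (0 : ℝ) 1))))
    (fun s hs y _ => (L.deriv_w s hs y).inv (L.pos s hs y).ne') ht
  have h2 : HasDerivAt (fun s => ∫ y in (0 : ℝ)..1, (w s y)⁻¹) 0 t :=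
    (hasDerivAt_const t (1 : ℝ)).congr_of_eventuallyEq (by
      filter_upwards [isOpen_Ioo.mem_nhds ht] with s hs using L.mean s hs)
  rw [velocity, L.labelMap_one ht]
  exact h1.unique h2

/-- Integrate the momentum equation over [0,1]. The strain has mean zero at all times because the
velocity vanishes at both ends, and integration by parts turns -∫ f f_xx into ∫ f_x². The
coefficient is thereby identified with the nonlocal term. -/
theorem c_eq (L : LagrangianFlow h r r' a b w wt wx wtx c) {t : ℝ} (ht : t ∈ Ioo a b) :
    c t = (∫ x in (0 : ℝ)..1, temp r w t x) - 2 * ∫ x in (0 : ℝ)..1, strain w wt t x ^ 2 := by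
  have cv := continuousOn_slice L.cont_velocity ht
  have cs := continuousOn_slice L.cont_strain ht
  have cg := continuousOn_slice L.cont_strainGrad ht
  have ct := continuousOn_slice L.cont_temp ht
  have hmean : ∀ s ∈ Ioo a b, ∫ x in (0 : ℝ)..1, strain w wt s x = 0 := fun s hs => by
    rw [intervalIntegral.integral_eq_sub_of_hasDerivAt
      (fun x _ => L.hasDerivAt_velocity hs x)
      (intervalIntegrable_of_Icc (continuousOn_slice L.cont_strain hs)),
      L.velocity_zero hs, L.velocity_one hs, sub_zero]
  have h0 : HasDerivAt (fun s => ∫ x in (0 : ℝ)..1, strain w wt s x) 0 t :=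
    (hasDerivAt_const t (0 : ℝ)).congr_of_eventuallyEq (by
      filter_upwards [isOpen_Ioo.mem_nhds ht] with s hs using hmean s hs)
  have hcont : ContinuousOn (fun p : ℝ × ℝ => c p.1 - velocity w wt p.1 p.2 *
      strainGrad w wt wx wtx p.1 p.2 + strain w wt p.1 p.2 ^ 2 - temp r w p.1 p.2)
      (Ioo a b ×ˢ Icc 0 1) := by
    have := L.cont_c.comp (t := Ioo a b) (s := Ioo a b ×ˢ Icc (0 : ℝ) 1) continuousOn_fst
      fun p hp => hp.1
    exact ((this.sub (L.cont_velocity.mul L.cont_strainGrad)).add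
      (L.cont_strain.pow 2)).sub L.cont_temp
  have h1 := hasDerivAt_parametric_integral (F' := fun t x => c t - velocity w wt t x *
      strainGrad w wt wx wtx t x + strain w wt t x ^ 2 - temp r w t x) isOpen_Ioo zero_le_one
    (fun s hs => continuousOn_slice L.cont_strain hs)
    hcont
    (fun s hs y hy => L.hasDerivAt_strain_time hs hy) ht
  have h2 := h1.unique h0
  have h3 : ∫ x in (0 : ℝ)..1,
      (strain w wt t x * strain w wt t x + velocity w wt t x * strainGrad w wt wx wtx t x) = 0 := by
    rw [intervalIntegral.integral_eq_sub_of_hasDerivAt_of_le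
      (f := fun x => velocity w wt t x * strain w wt t x) zero_le_one (cv.mul cs)
      (fun x hx => (L.hasDerivAt_velocity ht x).mul
        ((L.hasDerivWithinAt_strain ht (Ioo_subset_Icc_self hx)).hasDerivAt
          (Icc_mem_nhds hx.1 hx.2)))
      (intervalIntegrable_of_Icc ((cs.mul cs).add (cv.mul cg))),
      L.velocity_zero ht, L.velocity_one ht]
    simp
  have i1 : IntervalIntegrable (fun x => strain w wt t x * strain w wt t x) volume 0 1 :=
    intervalIntegrable_of_Icc (cs.mul cs)
  have i2 : IntervalIntegrable (fun x => velocity w wt t x * strainGrad w wt wx wtx t x) volume 0 1 :=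
    intervalIntegrable_of_Icc (cv.mul cg)
  have i3 : IntervalIntegrable (fun x => strain w wt t x ^ 2) volume 0 1 :=
    intervalIntegrable_of_Icc (cs.pow 2)
  have i4 := intervalIntegrable_of_Icc ct
  have i5 : IntervalIntegrable (fun _ : ℝ => c t) volume 0 1 := intervalIntegrable_const
  rw [intervalIntegral.integral_add i1 i2] at h3
  rw [intervalIntegral.integral_sub ((i5.sub i2).add i3) i4,
    intervalIntegral.integral_add (i5.sub i2) i3, intervalIntegral.integral_sub i5 i2] at h2
  simp only [intervalIntegral.integral_const, sub_zero, one_smul, ← pow_two] at h2 h3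
  linarith

theorem labelMap_init (L : LagrangianFlow h r r' a b w wt wx wtx c) (x : ℝ) :
    labelMap w 0 x = x := by
  have : flowMap w 0 x = x := by simp [flowMap, L.init_w]
  conv_lhs => rw [← this]
  exact L.labelMap_flowMap L.zero_mem x

theorem dx_velocity (L : LagrangianFlow h r r' a b w wt wx wtx c) {t : ℝ} (ht : t ∈ Ioo a b)
    {x : ℝ} (hx : x ∈ Icc (0 : ℝ) 1) : dx (velocity w wt t) x = strain w wt t x :=
  dx_eq hx (L.hasDerivAt_velocity ht x).hasDerivWithinAt

theorem dx_dx_velocity (L : LagrangianFlow h r r' a b w wt wx wtx c) {t : ℝ} (ht : t ∈ Ioo a b)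
    {x : ℝ} (hx : x ∈ Icc (0 : ℝ) 1) :
    dx (dx (velocity w wt t)) x = strainGrad w wt wx wtx t x :=
  (dx_congr (fun _ hy => L.dx_velocity ht hy) hx).trans
    (dx_eq hx (L.hasDerivWithinAt_strain ht hx))

theorem dx_temp (L : LagrangianFlow h r r' a b w wt wx wtx c) {t : ℝ} (ht : t ∈ Ioo a b)
    {x : ℝ} (hx : x ∈ Icc (0 : ℝ) 1) : dx (temp r w t) x = tempGrad r r' w wx t x :=
  dx_eq hx (L.hasDerivWithinAt_temp ht hx)

/-- A solution of the Lagrangian problem gives a classical solution. -/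
theorem isClassicalSolution (L : LagrangianFlow h r r' a b w wt wx wtx c) {f₀ ρ₀ : ℝ → ℝ}
    (hf₀ : ∀ x ∈ Icc (0 : ℝ) 1, f₀ x = ∫ y in (0 : ℝ)..x, h y)
    (hρ₀ : ∀ x ∈ Icc (0 : ℝ) 1, ρ₀ x = r x) :
    IsClassicalSolution f₀ ρ₀ b (velocity w wt) (temp r w) := by
  -- The Lagrangian flow also exists for slightly negative times, so t = 0 is an interior time and
  -- needs no one-sided treatment.
  have hsub : Ico 0 b ⊆ Ioo a b := fun t ht => ⟨L.zero_mem.1.trans_le ht.1, ht.2⟩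
  have hsub' : Ioo 0 b ⊆ Ioo a b := fun t ht => hsub ⟨ht.1.le, ht.2⟩
  have hp : Ico 0 b ×ˢ Icc (0 : ℝ) 1 ⊆ Ioo a b ×ˢ Icc (0 : ℝ) 1 := prod_mono hsub le_rfl
  have heq : ∀ t ∈ Ioo a b, ∀ x ∈ Icc (0 : ℝ) 1,
      (fun s => dx (velocity w wt s) x) =ᶠ[𝓝 t] fun s => strain w wt s x := fun t ht x hx => by
    filter_upwards [isOpen_Ioo.mem_nhds ht] with s hs using L.dx_velocity hs hx
  constructor
  · exact fun t ht => contDiffOn_two_of_hasDerivWithinAt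
      (fun x _ => (L.hasDerivAt_velocity (hsub ht) x).hasDerivWithinAt)
      (fun x hx => L.hasDerivWithinAt_strain (hsub ht) hx)
      (continuousOn_slice L.cont_strainGrad (hsub ht))
  · exact fun t ht => contDiffOn_one_of_hasDerivWithinAt
      (fun x hx => L.hasDerivWithinAt_temp (hsub ht) hx)
      (continuousOn_slice L.cont_tempGrad (hsub ht))
  · exact L.cont_velocity.mono hp
  · exact (L.cont_strain.mono hp).congr fun p hp => L.dx_velocity (hsub hp.1) hp.2
  · exact (L.cont_strainGrad.mono hp).congr fun p hp => L.dx_dx_velocity (hsub hp.1) hp.2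
  · exact L.cont_temp.mono hp
  · exact (L.cont_tempGrad.mono hp).congr fun p hp => L.dx_temp (hsub hp.1) hp.2
  · exact fun t ht x hx => ((L.hasDerivAt_strain_time (hsub' ht) hx).congr_of_eventuallyEq
      (heq t (hsub' ht) x hx)).differentiableAt
  · exact fun t ht x hx => (L.hasDerivAt_temp_time (hsub' ht) hx).differentiableAt
  · intro t ht x hx
    have ht' := hsub' ht
    rw [(heq t ht' x hx).deriv_eq, (L.hasDerivAt_strain_time ht' hx).deriv, L.dx_velocity ht' hx,
      L.dx_dx_velocity ht' hx, L.c_eq ht', nonlocalTerm]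
    have : ∫ x in (0 : ℝ)..1, dx (velocity w wt t) x ^ 2
        = ∫ x in (0 : ℝ)..1, strain w wt t x ^ 2 :=
      intervalIntegral.integral_congr fun y hy => by
        rw [uIcc_of_le zero_le_one] at hy
        simp only [L.dx_velocity ht' hy]
    rw [this]
    ring
  · intro t ht x hx
    have ht' := hsub' ht
    rw [(L.hasDerivAt_temp_time ht' hx).deriv, L.dx_velocity ht' hx, L.dx_temp ht' hx]
    ring
  · intro x hx
    simp [velocity, L.labelMap_init, L.init_w, L.init_wt, hf₀ x hx]
  · intro x hx
    simp [temp, L.labelMap_init, L.init_w, hρ₀ x hx]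
  · exact fun t ht => ⟨L.velocity_zero (hsub ht), L.velocity_one (hsub ht)⟩
  · exact fun t ht => by
      simp [temp, L.labelMap_zero (hsub ht), L.labelMap_one (hsub ht), L.r_zero, L.r_one]

end LagrangianFlow

/-! ### Uniqueness of classical solutions by an energy estimate -/

/-- A form of Cauchy–Schwarz, obtained by expanding ∫₀ˣ (φ - m)² ≥ 0 with m = ∫₀ˣ φ and using x ≤ 1.
-/
theorem sq_integral_le {φ : ℝ → ℝ} (hφ : ContinuousOn φ (Icc 0 1)) {x : ℝ}
    (hx : x ∈ Icc (0 : ℝ) 1) : (∫ y in (0 : ℝ)..x, φ y) ^ 2 ≤ ∫ y in (0 : ℝ)..1, φ y ^ 2 := by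
  set m := ∫ y in (0 : ℝ)..x, φ y with hm
  have hφx : ContinuousOn φ (uIcc 0 x) := by
    rw [uIcc_of_le hx.1]; exact hφ.mono (Icc_subset_Icc_right hx.2)
  have i1 : IntervalIntegrable φ volume 0 x := hφx.intervalIntegrable
  have i2 : IntervalIntegrable (fun y => φ y ^ 2) volume 0 x := (hφx.pow 2).intervalIntegrable
  have h0 : 0 ≤ ∫ y in (0 : ℝ)..x, (φ y - m) ^ 2 :=
    intervalIntegral.integral_nonneg hx.1 fun _ _ => sq_nonneg _
  have h1 : ∫ y in (0 : ℝ)..x, (φ y - m) ^ 2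
      = (∫ y in (0 : ℝ)..x, φ y ^ 2) - 2 * m * m + m ^ 2 * x := by
    have : ∀ y, (φ y - m) ^ 2 = φ y ^ 2 - 2 * m * φ y + m ^ 2 := fun y => by ring
    simp_rw [this]
    rw [intervalIntegral.integral_add (i2.sub (i1.const_mul _)) intervalIntegrable_const,
      intervalIntegral.integral_sub i2 (i1.const_mul _), intervalIntegral.integral_const_mul, ← hm]
    simp [mul_comm]
  have h2 : ∫ y in (0 : ℝ)..x, φ y ^ 2 ≤ ∫ y in (0 : ℝ)..1, φ y ^ 2 :=
    intervalIntegral.integral_mono_interval le_rfl hx.1 hx.2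
      (Eventually.of_forall fun _ => sq_nonneg _)
      (intervalIntegrable_of_Icc (hφ.pow 2))
  have h3 : m ^ 2 * x ≤ m ^ 2 := mul_le_of_le_one_right (sq_nonneg m) hx.2
  nlinarith

/-- Grönwall's inequality for a nonnegative quantity that vanishes initially. -/
theorem eq_zero_of_deriv_le {E E' : ℝ → ℝ} {K t₁ : ℝ} (h0 : E 0 = 0) (hpos : ∀ t, 0 ≤ E t)
    (hc : ContinuousOn E (Icc 0 t₁)) (hd : ∀ t ∈ Ioo 0 t₁, HasDerivAt E (E' t) t)
    (hle : ∀ t ∈ Ioo 0 t₁, E' t ≤ K * E t) {t : ℝ} (ht : t ∈ Icc 0 t₁) : E t = 0 := by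
  have hda : ∀ t ∈ Ioo 0 t₁, HasDerivAt (fun t => Real.exp (-K * t) * E t)
      (Real.exp (-K * t) * (-K * 1) * E t + Real.exp (-K * t) * E' t) t := fun t ht =>
    (((hasDerivAt_id t).const_mul (-K)).exp).mul (hd t ht)
  have hanti : AntitoneOn (fun t => Real.exp (-K * t) * E t) (Icc 0 t₁) := by
    refine antitoneOn_of_deriv_nonpos (convex_Icc _ _) ?_ ?_ ?_
    · exact ContinuousOn.mul (by fun_prop) hc
    · rw [interior_Icc]
      exact fun t ht => (hda t ht).differentiableAt.differentiableWithinAt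
    · rw [interior_Icc]
      intro t ht
      rw [(hda t ht).deriv]
      have := mul_le_mul_of_nonneg_left (hle t ht) (Real.exp_pos (-K * t)).le
      linarith
  have h1 := hanti (left_mem_Icc.2 (ht.1.trans ht.2)) ht ht.1
  simp only [h0, mul_zero] at h1
  have h2 := Real.exp_pos (-K * t)
  exact le_antisymm (nonpos_of_mul_nonpos_right h1 h2) (hpos t)

namespace IsClassicalSolution

variable {f₀ ρ₀ : ℝ → ℝ} {T : ℝ} {f ρ g σ : ℝ → ℝ → ℝ}

theorem mono (H : IsClassicalSolution f₀ ρ₀ T f ρ) {T' : ℝ} (h : T' ≤ T) :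
    IsClassicalSolution f₀ ρ₀ T' f ρ := by
  have h1 : Ico 0 T' ⊆ Ico 0 T := Ico_subset_Ico_right h
  have h2 : Ioo 0 T' ⊆ Ioo 0 T := Ioo_subset_Ioo_right h
  have h3 : Ico 0 T' ×ˢ Icc (0 : ℝ) 1 ⊆ Ico 0 T ×ˢ Icc (0 : ℝ) 1 := prod_mono h1 le_rfl
  exact ⟨fun t ht => H.contDiff_f t (h1 ht), fun t ht => H.contDiff_rho t (h1 ht),
    H.continuous_f.mono h3, H.continuous_fx.mono h3, H.continuous_fxx.mono h3,
    H.continuous_rho.mono h3, H.continuous_rhox.mono h3,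
    fun t ht => H.differentiable_fx t (h2 ht), fun t ht => H.differentiable_rho t (h2 ht),
    fun t ht => H.momentum t (h2 ht), fun t ht => H.temperature t (h2 ht),
    H.initial_f, H.initial_rho, fun t ht => H.boundary_f t (h1 ht),
    fun t ht => H.boundary_rho t (h1 ht)⟩

theorem hasDerivWithinAt_f (H : IsClassicalSolution f₀ ρ₀ T f ρ) {t x : ℝ} (ht : t ∈ Ico 0 T)
    (hx : x ∈ Icc (0 : ℝ) 1) : HasDerivWithinAt (f t) (dx (f t) x) (Icc 0 1) x :=
  ((H.contDiff_f t ht).differentiableOn (by norm_num) x hx).hasDerivWithinAt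

theorem hasDerivWithinAt_fx (H : IsClassicalSolution f₀ ρ₀ T f ρ) {t x : ℝ} (ht : t ∈ Ico 0 T)
    (hx : x ∈ Icc (0 : ℝ) 1) : HasDerivWithinAt (dx (f t)) (dx (dx (f t)) x) (Icc 0 1) x := by
  have h1 : ContDiffOn ℝ 1 (derivWithin (f t) (Icc 0 1)) (Icc 0 1) :=
    (H.contDiff_f t ht).derivWithin (uniqueDiffOn_Icc zero_lt_one) (by norm_num)
  exact (h1.differentiableOn (by norm_num) x hx).hasDerivWithinAt

theorem hasDerivWithinAt_rho (H : IsClassicalSolution f₀ ρ₀ T f ρ) {t x : ℝ} (ht : t ∈ Ico 0 T)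
    (hx : x ∈ Icc (0 : ℝ) 1) : HasDerivWithinAt (ρ t) (dx (ρ t) x) (Icc 0 1) x :=
  ((H.contDiff_rho t ht).differentiableOn (by norm_num) x hx).hasDerivWithinAt

theorem hasDerivAt_fx_time (H : IsClassicalSolution f₀ ρ₀ T f ρ) {t x : ℝ} (ht : t ∈ Ioo 0 T)
    (hx : x ∈ Icc (0 : ℝ) 1) : HasDerivAt (fun s => dx (f s) x)
      (nonlocalTerm f ρ t - f t x * dx (dx (f t)) x + dx (f t) x ^ 2 - ρ t x) t := by
  have h1 := (H.differentiable_fx t ht x hx).hasDerivAt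
  have h2 := H.momentum t ht x hx
  refine h1.congr_deriv ?_
  linarith

theorem hasDerivAt_rho_time (H : IsClassicalSolution f₀ ρ₀ T f ρ) {t x : ℝ} (ht : t ∈ Ioo 0 T)
    (hx : x ∈ Icc (0 : ℝ) 1) : HasDerivAt (fun s => ρ s x)
      (ρ t x * dx (f t) x - f t x * dx (ρ t) x) t := by
  have h1 := (H.differentiable_rho t ht x hx).hasDerivAt
  have h2 := H.temperature t ht x hx
  refine h1.congr_deriv ?_
  linarith

theorem cont_nonlocalTerm (H : IsClassicalSolution f₀ ρ₀ T f ρ) :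
    ContinuousOn (nonlocalTerm f ρ) (Ico 0 T) := by
  have h1 : ContinuousOn (fun p : ℝ × ℝ => dx (f p.1) p.2 ^ 2) (Ico 0 T ×ˢ Icc 0 1) :=
    H.continuous_fx.pow 2
  exact (continuousOn_parametric_integral zero_le_one H.continuous_rho).sub
    ((continuousOn_parametric_integral (F := fun t x => dx (f t) x ^ 2) zero_le_one
      h1).const_mul 2)

theorem integral_fx (H : IsClassicalSolution f₀ ρ₀ T f ρ) {t x : ℝ} (ht : t ∈ Ico 0 T)
    (hx : x ∈ Icc (0 : ℝ) 1) : ∫ y in (0 : ℝ)..x, dx (f t) y = f t x := by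
  have hc := continuousOn_slice (F := fun t x => dx (f t) x) H.continuous_fx ht
  have hcf := continuousOn_slice (F := f) H.continuous_f ht
  have hsub : Icc 0 x ⊆ Icc (0 : ℝ) 1 := Icc_subset_Icc_right hx.2
  rw [intervalIntegral.integral_eq_sub_of_hasDerivAt_of_le (f := f t) hx.1 (hcf.mono hsub)
    (fun y hy => (H.hasDerivWithinAt_f ht (hsub (Ioo_subset_Icc_self hy))).hasDerivAt
      (Icc_mem_nhds hy.1 (hy.2.trans_le hx.2)))
    (ContinuousOn.intervalIntegrable (by rw [uIcc_of_le hx.1]; exact hc.mono hsub)),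
    (H.boundary_f t ht).1, sub_zero]

/-- The energy of the difference of two solutions. -/
def energy (f ρ g σ : ℝ → ℝ → ℝ) (t : ℝ) : ℝ :=
  ∫ x in (0 : ℝ)..1, ((dx (f t) x - dx (g t) x) ^ 2 + (ρ t x - σ t x) ^ 2)

theorem energy_nonneg (t : ℝ) : 0 ≤ energy f ρ g σ t :=
  intervalIntegral.integral_nonneg zero_le_one fun _ _ => by positivity

theorem cont_energy_density (H : IsClassicalSolution f₀ ρ₀ T f ρ)
    (K : IsClassicalSolution f₀ ρ₀ T g σ) :
    ContinuousOn (fun p : ℝ × ℝ => (dx (f p.1) p.2 - dx (g p.1) p.2) ^ 2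
      + (ρ p.1 p.2 - σ p.1 p.2) ^ 2) (Ico 0 T ×ˢ Icc 0 1) :=
  ((H.continuous_fx.sub K.continuous_fx).pow 2).add
    ((H.continuous_rho.sub K.continuous_rho).pow 2)

/-- Both velocities vanish at 0, so their difference is the primitive of the difference of strains.
This controls the factor f - g that multiplies g_xx and σ_x in the energy production. -/
theorem sq_sub_le_energy (H : IsClassicalSolution f₀ ρ₀ T f ρ)
    (K : IsClassicalSolution f₀ ρ₀ T g σ) {t x : ℝ} (ht : t ∈ Ico 0 T) (hx : x ∈ Icc (0 : ℝ) 1) :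
    (f t x - g t x) ^ 2 ≤ energy f ρ g σ t := by
  have hf := continuousOn_slice (F := fun t x => dx (f t) x) H.continuous_fx ht
  have hg := continuousOn_slice (F := fun t x => dx (g t) x) K.continuous_fx ht
  have hsub : uIcc 0 x ⊆ Icc (0 : ℝ) 1 := by
    rw [uIcc_of_le hx.1]; exact Icc_subset_Icc_right hx.2
  have h1 := sq_integral_le (hf.sub hg) hx
  have h2 : ∫ y in (0 : ℝ)..x, (dx (f t) - dx (g t)) y = f t x - g t x := by
    simp only [Pi.sub_apply]
    rw [intervalIntegral.integral_sub (hf.mono hsub).intervalIntegrable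
      (hg.mono hsub).intervalIntegrable, H.integral_fx ht hx, K.integral_fx ht hx]
  rw [← h2]
  refine h1.trans (intervalIntegral.integral_mono_on zero_le_one
    (intervalIntegrable_of_Icc ((hf.sub hg).pow 2))
    (intervalIntegrable_of_Icc (continuousOn_slice
      (F := fun t x => (dx (f t) x - dx (g t) x) ^ 2 + (ρ t x - σ t x) ^ 2)
      (cont_energy_density H K) ht)) fun y _ => ?_)
  simp only [Pi.sub_apply, le_add_iff_nonneg_right]
  positivity

/-- The part of the energy production that is not an exact derivative. -/
def energyRate (f g ρ σ : ℝ → ℝ → ℝ) (t x : ℝ) : ℝ :=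
  dx (f t) x * ((dx (f t) x - dx (g t) x) ^ 2 + (ρ t x - σ t x) ^ 2)
  + 2 * (dx (f t) x - dx (g t) x) * (-(f t x - g t x) * dx (dx (g t)) x
    + (dx (f t) x + dx (g t) x) * (dx (f t) x - dx (g t) x) - (ρ t x - σ t x))
  + 2 * (ρ t x - σ t x) * (-(f t x - g t x) * dx (σ t) x + (ρ t x - σ t x) * dx (f t) x
    + σ t x * (dx (f t) x - dx (g t) x))

theorem cont_energyRate (H : IsClassicalSolution f₀ ρ₀ T f ρ)
    (K : IsClassicalSolution f₀ ρ₀ T g σ) :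
    ContinuousOn (fun p : ℝ × ℝ => energyRate f g ρ σ p.1 p.2) (Ico 0 T ×ˢ Icc 0 1) := by
  have h1 := H.continuous_f
  have h2 := H.continuous_fx
  have h4 := H.continuous_rho
  have k1 := K.continuous_f
  have k2 := K.continuous_fx
  have k3 := K.continuous_fxx
  have k4 := K.continuous_rho
  have k5 := K.continuous_rhox
  unfold energyRate
  fun_prop

theorem hasDerivAt_energy (H : IsClassicalSolution f₀ ρ₀ T f ρ)
    (K : IsClassicalSolution f₀ ρ₀ T g σ) {t : ℝ} (ht : t ∈ Ioo 0 T) :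
    HasDerivAt (energy f ρ g σ) (∫ x in (0 : ℝ)..1, energyRate f g ρ σ t x) t := by
  have hsub : Ioo 0 T ⊆ Ico 0 T := Ioo_subset_Ico_self
  have hsubp : Ioo 0 T ×ˢ Icc (0 : ℝ) 1 ⊆ Ico 0 T ×ˢ Icc (0 : ℝ) 1 := prod_mono hsub le_rfl
  have h1 := H.continuous_f
  have h2 := H.continuous_fx
  have h3 := H.continuous_fxx
  have h4 := H.continuous_rho
  have h5 := H.continuous_rhox
  have h6 : ContinuousOn (fun p : ℝ × ℝ => nonlocalTerm f ρ p.1) (Ico 0 T ×ˢ Icc 0 1) :=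
    H.cont_nonlocalTerm.comp continuousOn_fst fun p hp => hp.1
  have k1 := K.continuous_f
  have k2 := K.continuous_fx
  have k3 := K.continuous_fxx
  have k4 := K.continuous_rho
  have k5 := K.continuous_rhox
  have k6 : ContinuousOn (fun p : ℝ × ℝ => nonlocalTerm g σ p.1) (Ico 0 T ×ˢ Icc 0 1) :=
    K.cont_nonlocalTerm.comp continuousOn_fst fun p hp => hp.1
  -- The integrand produced by differentiating the energy density with the equations; it still
  -- contains f_xx and ρ_x of the first solution and the two nonlocal terms.
  let D : ℝ → ℝ → ℝ := fun t x =>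
    2 * (dx (f t) x - dx (g t) x) *
      ((nonlocalTerm f ρ t - f t x * dx (dx (f t)) x + dx (f t) x ^ 2 - ρ t x)
        - (nonlocalTerm g σ t - g t x * dx (dx (g t)) x + dx (g t) x ^ 2 - σ t x))
    + 2 * (ρ t x - σ t x) * ((ρ t x * dx (f t) x - f t x * dx (ρ t) x)
        - (σ t x * dx (g t) x - g t x * dx (σ t) x))
  have hD : ContinuousOn (fun p : ℝ × ℝ => D p.1 p.2) (Ico 0 T ×ˢ Icc 0 1) := by
    fun_prop
  have hE := hasDerivAt_parametric_integral (F' := D) isOpen_Ioo zero_le_one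
    (fun s hs => continuousOn_slice
      (F := fun t x => (dx (f t) x - dx (g t) x) ^ 2 + (ρ t x - σ t x) ^ 2)
      (cont_energy_density H K) (hsub hs))
    (hD.mono hsubp) (fun s hs y hy => by
      have := (((H.hasDerivAt_fx_time hs hy).sub (K.hasDerivAt_fx_time hs hy)).pow 2).add
        (((H.hasDerivAt_rho_time hs hy).sub (K.hasDerivAt_rho_time hs hy)).pow 2)
      refine this.congr_deriv ?_
      simp only [D, Pi.sub_apply]
      push_cast
      ring) ht
  refine hE.congr_deriv ?_
  have ht' := hsub ht
  -- The flux whose x-derivative is the exact part of `D`: it collects the nonlocal terms, which do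
  -- not depend on x, and the transport by f. It vanishes at 0 and 1 by the boundary conditions.
  let X : ℝ → ℝ := fun x =>
    2 * (nonlocalTerm f ρ t - nonlocalTerm g σ t) * (f t x - g t x)
      - f t x * ((dx (f t) x - dx (g t) x) ^ 2 + (ρ t x - σ t x) ^ 2)
  have hX : ∀ x ∈ Icc (0 : ℝ) 1,
      HasDerivWithinAt X (D t x - energyRate f g ρ σ t x) (Icc 0 1) x := fun x hx => by
    have a1 := H.hasDerivWithinAt_f ht' hx
    have a2 := K.hasDerivWithinAt_f ht' hx
    have a3 := (H.hasDerivWithinAt_fx ht' hx).sub (K.hasDerivWithinAt_fx ht' hx)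
    have a4 := (H.hasDerivWithinAt_rho ht' hx).sub (K.hasDerivWithinAt_rho ht' hx)
    have := ((a1.sub a2).const_mul (2 * (nonlocalTerm f ρ t - nonlocalTerm g σ t))).sub
      (a1.mul ((a3.pow 2).add (a4.pow 2)))
    refine this.congr_deriv ?_
    simp only [D, energyRate, Pi.sub_apply, Pi.add_apply, Pi.pow_apply]
    push_cast
    ring
  have i1 := intervalIntegrable_of_Icc (continuousOn_slice hD ht')
  have i2 := intervalIntegrable_of_Icc
    (continuousOn_slice (cont_energyRate H K) ht')
  have h7 : ∫ x in (0 : ℝ)..1, (D t x - energyRate f g ρ σ t x) = 0 := by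
    rw [intervalIntegral.integral_eq_sub_of_hasDerivAt_of_le (f := X) zero_le_one
      (fun x hx => (hX x hx).continuousWithinAt)
      (fun x hx => (hX x (Ioo_subset_Icc_self hx)).hasDerivAt (Icc_mem_nhds hx.1 hx.2))
      (i1.sub i2)]
    simp [X, (H.boundary_f t ht').1, (H.boundary_f t ht').2, (K.boundary_f t ht').1,
      (K.boundary_f t ht').2]
  rw [intervalIntegral.integral_sub i1 i2] at h7
  linarith

theorem two_mul_mul_le_of_abs_le {u v A C : ℝ} (hA : |A| ≤ C) :
    2 * (u * v * A) ≤ C * (u ^ 2 + v ^ 2) := by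
  have h1 : 2 * (u * v * A) ≤ 2 * (|u| * |v| * |A|) := by
    have := le_abs_self (u * v * A)
    rw [abs_mul, abs_mul] at this
    linarith
  have h2 : |u| * |v| * |A| ≤ |u| * |v| * C := by gcongr
  have h3 : 0 ≤ C := (abs_nonneg A).trans hA
  have h4 : 0 ≤ C * (|u| - |v|) ^ 2 := by positivity
  have h5 := sq_abs u
  have h6 := sq_abs v
  have : C * (|u| - |v|) ^ 2 = C * (u ^ 2 + v ^ 2) - 2 * (|u| * |v| * C) := by
    rw [← h5, ← h6]; ring
  linarith

/-- Every term is a product of two differences with a factor bounded by C or 2C, except for the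
cross term of strain and temperature, which accounts for the extra 1. The constant 8 is not sharp.
-/
theorem energyRate_le {C t x E : ℝ} (h1 : |dx (f t) x| ≤ C) (h2 : |dx (g t) x| ≤ C)
    (h3 : |dx (dx (g t)) x| ≤ C) (h4 : |σ t x| ≤ C) (h5 : |dx (σ t) x| ≤ C)
    (hE : (f t x - g t x) ^ 2 ≤ E) :
    energyRate f g ρ σ t x ≤ (8 * C + 1) * ((dx (f t) x - dx (g t) x) ^ 2 + (ρ t x - σ t x) ^ 2)
      + 2 * C * E := by
  unfold energyRate
  generalize f t x - g t x = F at *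
  generalize dx (f t) x = fx at *
  generalize dx (g t) x = gx at *
  generalize ρ t x - σ t x = R at *
  generalize dx (dx (g t)) x = gxx at *
  generalize dx (σ t) x = sx at *
  generalize σ t x = s at *
  set φ := fx - gx
  have hC : 0 ≤ C := (abs_nonneg _).trans h1
  have b1 := two_mul_mul_le_of_abs_le (u := φ) (v := φ) h1
  have b2 := two_mul_mul_le_of_abs_le (u := R) (v := R) h1
  have b3 := two_mul_mul_le_of_abs_le (u := φ) (v := φ) h2
  have b4 := two_mul_mul_le_of_abs_le (u := φ) (v := -F) h3
  have b5 := two_mul_mul_le_of_abs_le (u := R) (v := -F) h5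
  have b6 := two_mul_mul_le_of_abs_le (u := R) (v := φ) h4
  have b7 : 0 ≤ (φ + R) ^ 2 := sq_nonneg _
  have b8 : 2 * C * F ^ 2 ≤ 2 * C * E := by gcongr
  have b9 : 0 ≤ C * R ^ 2 := by positivity
  have b10 : 0 ≤ C * φ ^ 2 := by positivity
  nlinarith

theorem energy_eq_zero (H : IsClassicalSolution f₀ ρ₀ T f ρ)
    (K : IsClassicalSolution f₀ ρ₀ T g σ) {t : ℝ} (ht : t ∈ Ico 0 T) :
    energy f ρ g σ t = 0 := by
  have hsub : Icc 0 t ⊆ Ico 0 T := fun s hs => ⟨hs.1, hs.2.trans_lt ht.2⟩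
  have hcomp : IsCompact (Icc 0 t ×ˢ Icc (0 : ℝ) 1) := isCompact_Icc.prod isCompact_Icc
  have hbd : ∀ {G : ℝ → ℝ → ℝ}, ContinuousOn (fun p : ℝ × ℝ => G p.1 p.2) (Ico 0 T ×ˢ Icc 0 1) →
      ∃ B, ∀ s ∈ Icc 0 t, ∀ x ∈ Icc (0 : ℝ) 1, |G s x| ≤ B := fun hG => by
    obtain ⟨B, hB⟩ := hcomp.exists_bound_of_continuousOn (hG.mono (prod_mono hsub le_rfl))
    exact ⟨B, fun s hs x hx => hB (s, x) ⟨hs, hx⟩⟩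
  obtain ⟨B1, h1⟩ := hbd (G := fun t x => dx (f t) x) H.continuous_fx
  obtain ⟨B2, h2⟩ := hbd (G := fun t x => dx (g t) x) K.continuous_fx
  obtain ⟨B3, h3⟩ := hbd (G := fun t x => dx (dx (g t)) x) K.continuous_fxx
  obtain ⟨B4, h4⟩ := hbd (G := fun t x => σ t x) K.continuous_rho
  obtain ⟨B5, h5⟩ := hbd (G := fun t x => dx (σ t) x) K.continuous_rhox
  set C := max B1 (max B2 (max B3 (max B4 B5))) with hC
  have l1 : B1 ≤ C := by simp [hC]
  have l2 : B2 ≤ C := by simp [hC]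
  have l3 : B3 ≤ C := by simp [hC]
  have l4 : B4 ≤ C := by simp [hC]
  have l5 : B5 ≤ C := by simp [hC]
  have hdens := cont_energy_density H K
  have hE0 : energy f ρ g σ 0 = 0 := by
    have h0 : (0 : ℝ) ∈ Icc 0 t := ⟨le_rfl, ht.1⟩
    rw [energy, intervalIntegral.integral_congr (g := fun _ => (0 : ℝ)) fun x hx => ?_]
    · simp
    · rw [uIcc_of_le zero_le_one] at hx
      have e1 : dx (f 0) x = dx (g 0) x :=
        dx_congr (fun y hy => (H.initial_f y hy).trans (K.initial_f y hy).symm) hx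
      have e2 : ρ 0 x = σ 0 x := (H.initial_rho x hx).trans (K.initial_rho x hx).symm
      simp [e1, e2]
  have hEc : ContinuousOn (energy f ρ g σ) (Icc 0 t) :=
    (continuousOn_parametric_integral zero_le_one
      (F := fun t x => (dx (f t) x - dx (g t) x) ^ 2 + (ρ t x - σ t x) ^ 2) hdens).mono hsub
  -- The density contributes 8C + 1 and the pointwise bound on (f - g)² another 2C.
  refine eq_zero_of_deriv_le (K := 10 * C + 1) hE0 energy_nonneg hEc
    (fun s hs => hasDerivAt_energy H K ⟨hs.1, hs.2.trans ht.2⟩) (fun s hs => ?_)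
    (right_mem_Icc.2 ht.1)
  have hs' : s ∈ Icc 0 t := Ioo_subset_Icc_self hs
  have hsT := hsub hs'
  have i1 := intervalIntegrable_of_Icc (continuousOn_slice
    (F := fun t x => (dx (f t) x - dx (g t) x) ^ 2 + (ρ t x - σ t x) ^ 2) hdens hsT)
  have hle := intervalIntegral.integral_mono_on zero_le_one
    (intervalIntegrable_of_Icc
      (continuousOn_slice (cont_energyRate H K) hsT))
    ((i1.const_mul (8 * C + 1)).add
      (intervalIntegrable_const (c := 2 * C * energy f ρ g σ s))) fun x hx =>
    energyRate_le ((h1 s hs' x hx).trans l1) ((h2 s hs' x hx).trans l2)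
      ((h3 s hs' x hx).trans l3) ((h4 s hs' x hx).trans l4) ((h5 s hs' x hx).trans l5)
      (sq_sub_le_energy H K hsT hx)
  refine hle.trans_eq ?_
  rw [intervalIntegral.integral_add (i1.const_mul _) intervalIntegrable_const,
    intervalIntegral.integral_const_mul]
  simp only [energy, intervalIntegral.integral_const, smul_eq_mul]
  ring

/-- Classical solutions are unique. -/
theorem unique (H : IsClassicalSolution f₀ ρ₀ T f ρ) (K : IsClassicalSolution f₀ ρ₀ T g σ)
    {t x : ℝ} (ht : t ∈ Ico 0 T) (hx : x ∈ Icc (0 : ℝ) 1) : f t x = g t x ∧ ρ t x = σ t x := by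
  have hE := energy_eq_zero H K ht
  constructor
  · have := sq_sub_le_energy H K ht hx
    rw [hE] at this
    have h2 := pow_eq_zero_iff (two_ne_zero) |>.1 (le_antisymm this (sq_nonneg _))
    linarith
  · by_contra hne
    have hpos : 0 < energy f ρ g σ t := by
      refine intervalIntegral.integral_pos zero_lt_one (continuousOn_slice
        (F := fun t x => (dx (f t) x - dx (g t) x) ^ 2 + (ρ t x - σ t x) ^ 2)
        (cont_energy_density H K) ht) (fun _ _ => by positivity) ⟨x, hx, ?_⟩
      have := sq_pos_of_ne_zero (sub_ne_zero.2 hne)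
      positivity
    rw [hE] at hpos
    exact lt_irrefl _ hpos

end IsClassicalSolution

/-! ### Global solvability of a scalar second-order equation -/

/-- The first-order system equivalent to `g'' = Ψ(s, g)`. -/
def phaseField (Ψ : ℝ → ℝ → ℝ) (s : ℝ) (p : ℝ × ℝ) : ℝ × ℝ := (p.2, Ψ s p.1)

theorem lipschitzWith_phaseField {Ψ : ℝ → ℝ → ℝ} {s : ℝ} {K : ℝ≥0} (h : LipschitzWith K (Ψ s)) :
    LipschitzWith (max 1 K) (phaseField Ψ s) := by
  have h1 : LipschitzWith (K * 1) (fun p : ℝ × ℝ => Ψ s p.1) := h.comp LipschitzWith.prod_fst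
  rw [mul_one] at h1
  exact LipschitzWith.prod_snd.prodMk h1

theorem exists_phase_curve {a b : ℝ} (ha : a < 0) (hb : 0 < b) {Ψ : ℝ → ℝ → ℝ}
    (hcont : ∀ y, ContinuousOn (fun s => Ψ s y) (Icc a b)) {C K : ℝ≥0}
    (hbd : ∀ s ∈ Icc a b, ∀ y, |Ψ s y| ≤ C) (hlip : ∀ s ∈ Icc a b, LipschitzWith K (Ψ s)) :
    ∃ p : ℝ → ℝ × ℝ, p 0 = 0 ∧ ∀ s ∈ Ioo a b, HasDerivAt p (phaseField Ψ s (p s)) s := by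
  have hT0 : 0 < b - a := by linarith
  lift b - a to ℝ≥0 using hT0.le with T hT
  have hTne : (T : ℝ) ≠ 0 := hT0.ne'
  -- The second component is multiplied by the length T of the interval. On the ball of radius C T²
  -- both components of the field are then at most C T, so Picard–Lindelöf covers the whole interval
  -- with no smallness condition on T.
  let v : ℝ → ℝ × ℝ → ℝ × ℝ := fun s p => (T⁻¹ * p.2, T * Ψ s p.1)
  have hpl : IsPicardLindelof v (tmin := a) (tmax := b) ⟨0, ha.le, hb.le⟩ 0 (C * T ^ 2) 0 (C * T)
      (max T⁻¹ (T * K)) := by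
    constructor
    · intro s hs
      refine LipschitzWith.lipschitzOnWith ?_
      refine LipschitzWith.prodMk ?_ ?_
      · refine LipschitzWith.of_dist_le_mul fun p q => ?_
        rw [Real.dist_eq, ← mul_sub, abs_mul, NNReal.coe_inv, abs_of_nonneg (by positivity)]
        gcongr
        exact (le_max_right _ _)
      · refine LipschitzWith.of_dist_le_mul fun p q => ?_
        rw [Real.dist_eq, ← mul_sub, abs_mul, abs_of_nonneg (by positivity), NNReal.coe_mul,
          mul_assoc]
        gcongr
        refine ((hlip s hs).dist_le_mul p.1 q.1).trans ?_
        gcongr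
        exact le_max_left _ _
    · intro p _
      exact continuousOn_const.prodMk ((hcont p.1).const_mul _)
    · intro s hs p hp
      rw [mem_closedBall_zero_iff] at hp
      have h2 : ‖p.2‖ ≤ C * T ^ 2 := (norm_snd_le p).trans (by exact_mod_cast hp)
      refine max_le ?_ ?_
      · show ‖(T : ℝ)⁻¹ * p.2‖ ≤ _
        rw [norm_mul, norm_inv, Real.norm_of_nonneg hT0.le]
        push_cast
        calc (T : ℝ)⁻¹ * ‖p.2‖ ≤ (T : ℝ)⁻¹ * (C * T ^ 2) := by gcongr
          _ = C * T := by field_simp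
      · show ‖(T : ℝ) * Ψ s p.1‖ ≤ _
        rw [norm_mul, Real.norm_of_nonneg hT0.le]
        push_cast
        rw [mul_comm]
        gcongr
        exact hbd s hs _
    · push_cast
      have : max (b - 0) (0 - a) ≤ T := max_le (by linarith) (by linarith)
      calc (C : ℝ) * T * max (b - 0) (0 - a) ≤ C * T * T := by gcongr
        _ = C * T ^ 2 - 0 := by ring
  obtain ⟨q, hq0, hq⟩ := hpl.exists_eq_forall_mem_Icc_hasDerivWithinAt₀
  refine ⟨fun s => ((q s).1, (T : ℝ)⁻¹ * (q s).2), ?_, fun s hs => ?_⟩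
  · simp only at hq0
    simp [hq0]
  · have h1 := (hq s (Ioo_subset_Icc_self hs)).hasDerivAt (Icc_mem_nhds hs.1 hs.2)
    have h2 : HasDerivAt (fun s => (q s).1) (T⁻¹ * (q s).2) s :=
      (hasFDerivAt_fst (𝕜 := ℝ) (p := q s)).comp_hasDerivAt s h1
    have h3 : HasDerivAt (fun s => (q s).2) (T * Ψ s (q s).1) s :=
      (hasFDerivAt_snd (𝕜 := ℝ) (p := q s)).comp_hasDerivAt s h1
    refine (h2.prodMk (h3.const_mul (T : ℝ)⁻¹)).congr_deriv ?_
    simp only [phaseField, NNReal.coe_inv, inv_mul_cancel_left₀ hTne]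

/-- Global solvability of `g'' = Ψ(s, g)`, `g(0) = g'(0) = 0`, when `Ψ` is bounded and Lipschitz
in `g`, locally uniformly in `s`. -/
theorem exists_global_second_order {a b : ℝ} (ha : a < 0) (hb : 0 < b) {Ψ : ℝ → ℝ → ℝ}
    (hcont : ∀ y, ContinuousOn (fun s => Ψ s y) (Ioo a b))
    (hbd : ∀ a' b', a < a' → b' < b → ∃ C K : ℝ≥0, ∀ s ∈ Icc a' b',
      (∀ y, |Ψ s y| ≤ C) ∧ LipschitzWith K (Ψ s)) :
    ∃ g k : ℝ → ℝ, g 0 = 0 ∧ k 0 = 0 ∧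
      ∀ s ∈ Ioo a b, HasDerivAt g (k s) s ∧ HasDerivAt k (Ψ s (g s)) s := by
  -- Solve on the shrunken intervals (θa, θb) with θ < 1, where the bounds are uniform, and glue by
  -- uniqueness. Values of θ outside (0,1) receive a dummy curve.
  have hloc : ∀ θ : ℝ, ∃ p : ℝ → ℝ × ℝ, 0 < θ → θ < 1 →
      p 0 = 0 ∧ ∀ s ∈ Ioo (θ * a) (θ * b), HasDerivAt p (phaseField Ψ s (p s)) s := fun θ => by
    by_cases hθ : 0 < θ ∧ θ < 1
    · obtain ⟨C, K, h⟩ := hbd (θ * a) (θ * b) (by nlinarith) (by nlinarith)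
      obtain ⟨p, hp⟩ := exists_phase_curve (a := θ * a) (b := θ * b) (by nlinarith [hθ.1])
        (by nlinarith [hθ.1])
        (fun y => (hcont y).mono fun s hs => ⟨by nlinarith [hs.1], by nlinarith [hs.2]⟩)
        (fun s hs => (h s hs).1) (fun s hs => (h s hs).2)
      exact ⟨p, fun _ _ => hp⟩
    · exact ⟨0, fun h1 h2 => absurd ⟨h1, h2⟩ hθ⟩
  choose p hp using hloc
  have huniq : ∀ θ θ' : ℝ, 0 < θ → θ ≤ θ' → θ' < 1 →
      EqOn (p θ) (p θ') (Ioo (θ * a) (θ * b)) := by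
    intro θ θ' h0 h1 h2
    obtain ⟨C, K, h⟩ := hbd (θ * a) (θ * b) (by nlinarith) (by nlinarith)
    refine ODE_solution_unique_of_mem_Ioo (v := phaseField Ψ) (s := fun _ => univ) (t₀ := 0)
      (K := max 1 K) (fun t ht => ?_) ⟨by nlinarith, by nlinarith⟩
      (fun t ht => ⟨(hp θ h0 (h1.trans_lt h2)).2 t ht, mem_univ _⟩)
      (fun t ht => ⟨(hp θ' (h0.trans_le h1) h2).2 t
        ⟨by nlinarith [ht.1], by nlinarith [ht.2]⟩, mem_univ _⟩) ?_
    · exact (lipschitzWith_phaseField (h t (Ioo_subset_Icc_self ht)).2).lipschitzOnWith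
    · rw [(hp θ h0 (h1.trans_lt h2)).1, (hp θ' (h0.trans_le h1) h2).1]
  have huniq' : ∀ θ θ' : ℝ, 0 < θ → θ < 1 → 0 < θ' → θ' < 1 → ∀ s ∈ Ioo (θ * a) (θ * b),
      s ∈ Ioo (θ' * a) (θ' * b) → p θ s = p θ' s := fun θ θ' h1 h2 h3 h4 s hs hs' => by
    rcases le_total θ θ' with h | h
    · exact huniq θ θ' h1 h h4 hs
    · exact (huniq θ' θ h3 h h2 hs').symm
  have hex : ∀ s : ℝ, ∃ θ : ℝ, 0 < θ ∧ θ < 1 ∧ (s ∈ Ioo a b → s ∈ Ioo (θ * a) (θ * b)) := by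
    intro s
    by_cases hs : s ∈ Ioo a b
    · obtain ⟨θ, h1, h2⟩ := exists_between
        (show max (1 / 2) (max (s / a) (s / b)) < 1 from max_lt (by norm_num) (max_lt
          (by rw [div_lt_one_of_neg ha]; exact hs.1) (by rw [div_lt_one hb]; exact hs.2)))
      have h3 : 1 / 2 < θ := (le_max_left _ _).trans_lt h1
      have h4 : s / a < θ := ((le_max_left _ _).trans (le_max_right _ _)).trans_lt h1
      have h5 : s / b < θ := ((le_max_right _ _).trans (le_max_right _ _)).trans_lt h1
      exact ⟨θ, by linarith, h2, fun _ => ⟨(div_lt_iff_of_neg ha).1 h4, (div_lt_iff₀ hb).1 h5⟩⟩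
    · exact ⟨1 / 2, by norm_num, by norm_num, fun h => absurd h hs⟩
  choose θ hθ0 hθ1 hθ using hex
  have hmem0 : (0 : ℝ) ∈ Ioo a b := ⟨ha, hb⟩
  have hd : ∀ s ∈ Ioo a b, HasDerivAt (fun s => p (θ s) s) (phaseField Ψ s (p (θ s) s)) s := by
    intro s hs
    refine ((hp (θ s) (hθ0 s) (hθ1 s)).2 s (hθ s hs)).congr_of_eventuallyEq ?_
    filter_upwards [isOpen_Ioo.mem_nhds hs, isOpen_Ioo.mem_nhds (hθ s hs)] with s' h1 h2
    exact huniq' _ _ (hθ0 s') (hθ1 s') (hθ0 s) (hθ1 s) s' (hθ s' h1) h2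
  refine ⟨fun s => (p (θ s) s).1, fun s => (p (θ s) s).2, ?_, ?_, fun s hs => ⟨?_, ?_⟩⟩
  · simp [(hp (θ 0) (hθ0 0) (hθ1 0)).1]
  · simp [(hp (θ 0) (hθ0 0) (hθ1 0)).1]
  · exact hasFDerivAt_fst.comp_hasDerivAt s (hd s hs)
  · exact hasFDerivAt_snd.comp_hasDerivAt s (hd s hs)

/-! ### The amplitude equation in stretched time -/

/-- The reciprocal Jacobian, up to normalisation, in the stretched time `η`. -/
def denom (h r g : ℝ → ℝ) (η x : ℝ) : ℝ := 1 - h x * η + r x * g η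

/-- The normalising factor that makes the Jacobian have mean one. -/
def meanInv (h r g : ℝ → ℝ) (η : ℝ) : ℝ := ∫ x in (0 : ℝ)..1, (denom h r g η x)⁻¹

/-- Admissible data: continuous bounded functions with `h ≤ M` and `r ≥ 0`. -/
structure Admissible (h r : ℝ → ℝ) (M H : ℝ) : Prop where
  cont_h : Continuous h
  cont_r : Continuous r
  M_pos : 0 < M
  h_le : ∀ x, h x ≤ M
  abs_h_le : ∀ x, |h x| ≤ H
  r_nonneg : ∀ x, 0 ≤ r x
  r_le : ∀ x, r x ≤ H

/-- The nonlocal nonlinearity governing the amplitude of the temperature. -/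
def amplitudeRate (h r : ℝ → ℝ) (η y : ℝ) : ℝ :=
  (∫ x in (0 : ℝ)..1, (1 - h x * η + r x * max y 0)⁻¹) ^ 3

namespace Admissible

variable {h r : ℝ → ℝ} {M H : ℝ}

/-- For η ≥ 0 the danger comes from the maximum M of h, for η ≤ 0 from the bound -H; the temperature
term only helps. -/
theorem lower_bound (A : Admissible h r M H) {a' b' η y : ℝ} (hη : η ∈ Icc a' b')
    (hy : 0 ≤ y) (x : ℝ) : min (1 + H * a') (1 - M * b') ≤ 1 - h x * η + r x * y := by
  have h1 := abs_le.1 (A.abs_h_le x)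
  have h2 := A.h_le x
  have h3 := mul_nonneg (A.r_nonneg x) hy
  have hH : 0 ≤ H := (abs_nonneg _).trans (A.abs_h_le x)
  rcases le_total 0 η with h0 | h0
  · refine (min_le_right _ _).trans ?_
    nlinarith [hη.2, A.M_pos]
  · refine (min_le_left _ _).trans ?_
    nlinarith [hη.1]

theorem lower_bound_pos (A : Admissible h r M H) (hH : 0 < H) {a' b' : ℝ} (ha : -H⁻¹ < a')
    (hb : b' < M⁻¹) : 0 < min (1 + H * a') (1 - M * b') := by
  refine lt_min ?_ ?_
  · have := mul_lt_mul_of_pos_left ha hH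
    rw [mul_neg, mul_inv_cancel₀ hH.ne'] at this
    linarith
  · have := mul_lt_mul_of_pos_left hb A.M_pos
    rw [mul_inv_cancel₀ A.M_pos.ne'] at this
    linarith

theorem pos (A : Admissible h r M H) (hH : 0 < H) {η y : ℝ} (hη : η ∈ Ioo (-H⁻¹) M⁻¹)
    (hy : 0 ≤ y) (x : ℝ) : 0 < 1 - h x * η + r x * y :=
  (A.lower_bound_pos hH hη.1 hη.2).trans_le (A.lower_bound ⟨le_rfl, le_rfl⟩ hy x)

theorem continuousOn_amplitudeRate (A : Admissible h r M H) (hH : 0 < H) (y : ℝ) :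
    ContinuousOn (fun η => amplitudeRate h r η y) (Ioo (-H⁻¹) M⁻¹) := by
  refine ContinuousOn.pow (continuousOn_parametric_integral
    (F := fun η x => (1 - h x * η + r x * max y 0)⁻¹) zero_le_one ?_) 3
  have := A.cont_h
  have := A.cont_r
  refine ContinuousOn.inv₀ (f := fun p : ℝ × ℝ => 1 - h p.2 * p.1 + r p.2 * max y 0)
    (by fun_prop) fun p hp => ?_
  exact (A.pos hH hp.1 (le_max_right _ _) _).ne'

/-- Truncating at max y 0 keeps the denominator above a positive m for every real y, so on compact
η-intervals the integral is at most 1/m and H/m²-Lipschitz; the cube is then treated by factoring p³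
- q³. -/
theorem amplitudeRate_bounds (A : Admissible h r M H) (hH : 0 < H) {a' b' : ℝ} (ha : -H⁻¹ < a')
    (hb : b' < M⁻¹) : ∃ C K : ℝ≥0, ∀ η ∈ Icc a' b',
      (∀ y, |amplitudeRate h r η y| ≤ C) ∧ LipschitzWith K (amplitudeRate h r η) := by
  set m := min (1 + H * a') (1 - M * b') with hm
  have hm0 : 0 < m := A.lower_bound_pos hH ha hb
  have hch := A.cont_h
  have hcr := A.cont_r
  have hlow : ∀ η ∈ Icc a' b', ∀ y x, m ≤ 1 - h x * η + r x * max y 0 := fun η hη y x =>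
    A.lower_bound hη (le_max_right _ _) x
  have hcont : ∀ η ∈ Icc a' b', ∀ y, Continuous fun x => (1 - h x * η + r x * max y 0)⁻¹ :=
    fun η hη y => Continuous.inv₀ (by fun_prop) fun x => (hm0.trans_le (hlow η hη y x)).ne'
  have hnorm : ∀ η ∈ Icc a' b', ∀ y,
      |∫ x in (0 : ℝ)..1, (1 - h x * η + r x * max y 0)⁻¹| ≤ m⁻¹ := fun η hη y => by
    have := intervalIntegral.norm_integral_le_of_norm_le_const (a := 0) (b := 1) (C := m⁻¹)
      (f := fun x => (1 - h x * η + r x * max y 0)⁻¹) fun x _ => by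
        rw [norm_inv, Real.norm_of_nonneg (hm0.le.trans (hlow η hη y x))]
        exact inv_anti₀ hm0 (hlow η hη y x)
    simpa using this
  have hlip : ∀ η ∈ Icc a' b', ∀ y z,
      |(∫ x in (0 : ℝ)..1, (1 - h x * η + r x * max y 0)⁻¹)
        - ∫ x in (0 : ℝ)..1, (1 - h x * η + r x * max z 0)⁻¹| ≤ H * m⁻¹ ^ 2 * |y - z| := by
    intro η hη y z
    rw [← intervalIntegral.integral_sub ((hcont η hη y).intervalIntegrable _ _)
      ((hcont η hη z).intervalIntegrable _ _)]
    have := intervalIntegral.norm_integral_le_of_norm_le_const (a := 0) (b := 1)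
      (C := H * m⁻¹ ^ 2 * |y - z|)
      (f := fun x => (1 - h x * η + r x * max y 0)⁻¹ - (1 - h x * η + r x * max z 0)⁻¹)
      fun x _ => by
        have p1 := hm0.trans_le (hlow η hη y x)
        have p2 := hm0.trans_le (hlow η hη z x)
        rw [inv_sub_inv p1.ne' p2.ne', norm_div, Real.norm_eq_abs, Real.norm_eq_abs,
          abs_of_pos (mul_pos p1 p2)]
        have e1 : |1 - h x * η + r x * max z 0 - (1 - h x * η + r x * max y 0)|
            ≤ H * |y - z| := by
          rw [show 1 - h x * η + r x * max z 0 - (1 - h x * η + r x * max y 0)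
            = r x * (max z 0 - max y 0) by ring, abs_mul, abs_of_nonneg (A.r_nonneg x)]
          have : |max z 0 - max y 0| ≤ |y - z| := by
            rw [abs_sub_comm y z]; exact abs_max_sub_max_le_abs z y 0
          gcongr
          exact A.r_le x
        calc _ ≤ H * |y - z| / (m * m) := by
              gcongr
              · exact hlow η hη y x
              · exact hlow η hη z x
          _ = H * m⁻¹ ^ 2 * |y - z| := by field_simp
    simpa using this
  refine ⟨⟨m⁻¹ ^ 3, by positivity⟩, ⟨3 * m⁻¹ ^ 2 * (H * m⁻¹ ^ 2), by positivity⟩,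
    fun η hη => ⟨fun y => ?_, ?_⟩⟩
  · rw [amplitudeRate, abs_pow]
    exact pow_le_pow_left₀ (abs_nonneg _) (hnorm η hη y) 3
  · refine LipschitzWith.of_dist_le_mul fun y z => ?_
    rw [Real.dist_eq, Real.dist_eq]
    unfold amplitudeRate
    have n1 := hnorm η hη y
    have n2 := hnorm η hη z
    have n3 := hlip η hη y z
    set p := ∫ x in (0 : ℝ)..1, (1 - h x * η + r x * max y 0)⁻¹
    set q := ∫ x in (0 : ℝ)..1, (1 - h x * η + r x * max z 0)⁻¹
    have e : p ^ 3 - q ^ 3 = (p ^ 2 + p * q + q ^ 2) * (p - q) := by ring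
    have e2 : |p ^ 2 + p * q + q ^ 2| ≤ 3 * m⁻¹ ^ 2 := by
      calc |p ^ 2 + p * q + q ^ 2| ≤ |p| ^ 2 + |p| * |q| + |q| ^ 2 := by
            refine (abs_add_le _ _).trans (add_le_add ((abs_add_le _ _).trans ?_) ?_)
            · rw [abs_pow, abs_mul]
            · rw [abs_pow]
        _ ≤ m⁻¹ ^ 2 + m⁻¹ * m⁻¹ + m⁻¹ ^ 2 := by gcongr
        _ = 3 * m⁻¹ ^ 2 := by ring
    rw [e, abs_mul]
    calc _ ≤ 3 * m⁻¹ ^ 2 * (H * m⁻¹ ^ 2 * |y - z|) := by gcongr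
      _ = _ := by rw [← mul_assoc]; rfl

end Admissible

/-- The solution of the amplitude equation on the maximal interval of stretched time. -/
structure Amplitude (h r : ℝ → ℝ) (M H : ℝ) (g k : ℝ → ℝ) : Prop extends Admissible h r M H where
  H_pos : 0 < H
  g_zero : g 0 = 0
  k_zero : k 0 = 0
  g_nonneg : ∀ η ∈ Ioo (-H⁻¹) M⁻¹, 0 ≤ g η
  k_nonneg : ∀ η ∈ Ioo (-H⁻¹) M⁻¹, 0 ≤ η → 0 ≤ k η
  deriv_g : ∀ η ∈ Ioo (-H⁻¹) M⁻¹, HasDerivAt g (k η) η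
  deriv_k : ∀ η ∈ Ioo (-H⁻¹) M⁻¹, HasDerivAt k (meanInv h r g η ^ 3) η

theorem nonneg_of_deriv_sign {a b : ℝ} {g k : ℝ → ℝ} (h0 : (0 : ℝ) ∈ Ioo a b) (hg0 : g 0 = 0)
    (hd : ∀ s ∈ Ioo a b, HasDerivAt g (k s) s) (hk : ∀ s ∈ Ioo a b, 0 ≤ s * k s) {s : ℝ}
    (hs : s ∈ Ioo a b) : 0 ≤ g s := by
  have hc : ContinuousOn g (Ioo a b) := fun s hs => (hd s hs).continuousAt.continuousWithinAt
  rcases le_total 0 s with h | h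
  · have hsub : Icc 0 s ⊆ Ioo a b := fun x hx => ⟨h0.1.trans_le hx.1, hx.2.trans_lt hs.2⟩
    have : MonotoneOn g (Icc 0 s) := by
      refine monotoneOn_of_deriv_nonneg (convex_Icc _ _) (hc.mono hsub) ?_ ?_
      · rw [interior_Icc]
        exact fun x hx => (hd x (hsub (Ioo_subset_Icc_self hx))).differentiableAt
          |>.differentiableWithinAt
      · rw [interior_Icc]
        intro x hx
        rw [(hd x (hsub (Ioo_subset_Icc_self hx))).deriv]
        exact nonneg_of_mul_nonneg_right (hk x (hsub (Ioo_subset_Icc_self hx))) hx.1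
    simpa [hg0] using this (left_mem_Icc.2 h) (right_mem_Icc.2 h) h
  · have hsub : Icc s 0 ⊆ Ioo a b := fun x hx => ⟨hs.1.trans_le hx.1, hx.2.trans_lt h0.2⟩
    have : AntitoneOn g (Icc s 0) := by
      refine antitoneOn_of_deriv_nonpos (convex_Icc _ _) (hc.mono hsub) ?_ ?_
      · rw [interior_Icc]
        exact fun x hx => (hd x (hsub (Ioo_subset_Icc_self hx))).differentiableAt
          |>.differentiableWithinAt
      · rw [interior_Icc]
        intro x hx
        rw [(hd x (hsub (Ioo_subset_Icc_self hx))).deriv]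
        have := hk x (hsub (Ioo_subset_Icc_self hx))
        by_contra hcon
        have := mul_neg_of_neg_of_pos hx.2 (not_le.1 hcon)
        linarith
    simpa [hg0] using this (left_mem_Icc.2 h) (right_mem_Icc.2 h) h

/-- The rate is nonnegative, so k = g' is increasing with k(0) = 0 and g has its minimum 0 at the
origin. Thus g ≥ 0 and the truncation in `amplitudeRate` is never active. -/
theorem Admissible.exists_amplitude {h r : ℝ → ℝ} {M H : ℝ} (A : Admissible h r M H)
    (hH : 0 < H) : ∃ g k, Amplitude h r M H g k := by
  have ha : -H⁻¹ < 0 := by simpa using hH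
  have hb : 0 < M⁻¹ := inv_pos.2 A.M_pos
  obtain ⟨g, k, hg0, hk0, hd⟩ := exists_global_second_order ha hb
    (A.continuousOn_amplitudeRate hH) fun a' b' h1 h2 => A.amplitudeRate_bounds hH h1 h2
  have hrate : ∀ η ∈ Ioo (-H⁻¹) M⁻¹, 0 ≤ amplitudeRate h r η (g η) := fun η hη =>
    pow_nonneg (intervalIntegral.integral_nonneg zero_le_one fun x _ =>
      (inv_pos.2 (A.pos hH hη (le_max_right _ _) x)).le) 3
  have hmem : (0 : ℝ) ∈ Ioo (-H⁻¹) M⁻¹ := ⟨ha, hb⟩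
  have hkmono : MonotoneOn k (Ioo (-H⁻¹) M⁻¹) := by
    refine monotoneOn_of_deriv_nonneg (convex_Ioo _ _)
      (fun s hs => (hd s hs).2.continuousAt.continuousWithinAt) ?_ ?_
    · rw [interior_Ioo]
      exact fun s hs => (hd s hs).2.differentiableAt.differentiableWithinAt
    · rw [interior_Ioo]
      intro s hs
      rw [(hd s hs).2.deriv]
      exact hrate s hs
  have hk1 : ∀ s ∈ Ioo (-H⁻¹) M⁻¹, 0 ≤ s → 0 ≤ k s := fun s hs h => by
    simpa [hk0] using hkmono hmem hs h
  have hk2 : ∀ s ∈ Ioo (-H⁻¹) M⁻¹, s ≤ 0 → k s ≤ 0 := fun s hs h => by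
    simpa [hk0] using hkmono hs hmem h
  have hgpos : ∀ s ∈ Ioo (-H⁻¹) M⁻¹, 0 ≤ g s := fun s hs =>
    nonneg_of_deriv_sign hmem hg0 (fun s hs => (hd s hs).1) (fun s hs => by
      rcases le_total 0 s with h | h
      · exact mul_nonneg h (hk1 s hs h)
      · exact mul_nonneg_of_nonpos_of_nonpos h (hk2 s hs h)) hs
  refine ⟨g, k, A, hH, hg0, hk0, hgpos, hk1, fun η hη => (hd η hη).1, fun η hη => ?_⟩
  have := (hd η hη).2
  rwa [amplitudeRate, max_eq_left (hgpos η hη)] at this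

/-! ### Change of time -/

/-- Inverting the clock `τ(η) = ∫₀^η q`, whose total duration is finite. -/
theorem exists_time_change {a b : ℝ} (ha : a < 0) (hb : 0 < b) {q : ℝ → ℝ}
    (hq : ContinuousOn q (Ioo a b)) (hpos : ∀ η ∈ Ioo a b, 0 < q η) {B : ℝ}
    (hB : ∀ η ∈ Ico 0 b, ∫ s in (0 : ℝ)..η, q s ≤ B) :
    ∃ (ta tb : ℝ) (e : ℝ → ℝ), ta < 0 ∧ 0 < tb ∧ e 0 = 0 ∧
      (∀ t ∈ Ioo ta tb, e t ∈ Ioo a b ∧ HasDerivAt e (q (e t))⁻¹ t) ∧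
      (∀ t ∈ Ico 0 tb, 0 ≤ e t) ∧ Tendsto e (𝓝[<] tb) (𝓝[<] b) := by
  set τ : ℝ → ℝ := fun η => ∫ s in (0 : ℝ)..η, q s with hτ
  have h0 : (0 : ℝ) ∈ Ioo a b := ⟨ha, hb⟩
  have hd : ∀ η ∈ Ioo a b, HasDerivAt τ (q η) η := fun η hη => by
    have hsub : uIcc 0 η ⊆ Ioo a b := OrdConnected.uIcc_subset ordConnected_Ioo h0 hη
    exact intervalIntegral.integral_hasDerivAt_right (hq.mono hsub).intervalIntegrable
      (hq.stronglyMeasurableAtFilter isOpen_Ioo η hη)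
      (hq.continuousAt (isOpen_Ioo.mem_nhds hη))
  have hτc : ContinuousOn τ (Ioo a b) := fun η hη => (hd η hη).continuousAt.continuousWithinAt
  have hmono : StrictMonoOn τ (Ioo a b) := by
    refine strictMonoOn_of_deriv_pos (convex_Ioo _ _) hτc ?_
    rw [interior_Ioo]
    intro η hη
    rw [(hd η hη).deriv]
    exact hpos η hη
  have hτ0 : τ 0 = 0 := by simp [hτ]
  -- Only some negative time is needed, so the clock is inverted on (a/2, b) and no control near a
  -- is required.
  have ha2 : a / 2 ∈ Ioo a b := ⟨by linarith, by linarith⟩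
  have hbdd : BddAbove (τ '' Ico 0 b) := ⟨B, by rintro _ ⟨η, hη, rfl⟩; exact hB η hη⟩
  have hne : (τ '' Ico 0 b).Nonempty := ⟨τ 0, 0, ⟨le_rfl, hb⟩, rfl⟩
  -- The total duration of the clock, finite by the bound B; it becomes the blowup time.
  set tb := sSup (τ '' Ico 0 b) with htb
  have hlt : ∀ η ∈ Ioo a b, τ η < tb := fun η hη => by
    obtain ⟨η', h1, h2⟩ := exists_between (max_lt hη.2 hb)
    have h1' := (le_max_left _ _).trans_lt h1
    have h1'' := (le_max_right _ _).trans_lt h1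
    exact (hmono hη ⟨hη.1.trans h1', h2⟩ h1').trans_le
      (le_csSup hbdd ⟨η', ⟨h1''.le, h2⟩, rfl⟩)
  have hex : ∀ t, ∃ η, t ∈ Ioo (τ (a / 2)) tb → η ∈ Ioo (a / 2) b ∧ τ η = t := fun t => by
    by_cases ht : t ∈ Ioo (τ (a / 2)) tb
    · obtain ⟨_, ⟨η, hη, rfl⟩, hη2⟩ := exists_lt_of_lt_csSup hne ht.2
      have hη' : η ∈ Ioo a b := ⟨ha.trans_le hη.1, hη.2⟩
      have hle : a / 2 ≤ η := by linarith [hη.1]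
      have hsub : Icc (a / 2) η ⊆ Ioo a b := fun x hx =>
        ⟨ha2.1.trans_le hx.1, hx.2.trans_lt hη.2⟩
      obtain ⟨ξ, hξ, hξt⟩ := intermediate_value_Ioo hle (hτc.mono hsub) ⟨ht.1, hη2⟩
      exact ⟨ξ, fun _ => ⟨⟨hξ.1, hξ.2.trans hη.2⟩, hξt⟩⟩
    · exact ⟨0, fun h => absurd h ht⟩
  choose e he using hex
  have hsub : Ioo (a / 2) b ⊆ Ioo a b := Ioo_subset_Ioo_left ha2.1.le
  have hmem : ∀ t ∈ Ioo (τ (a / 2)) tb, e t ∈ Ioo a b := fun t ht => hsub (he t ht).1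
  have hinv : ∀ η ∈ Ioo (a / 2) b, e (τ η) = η := fun η hη => by
    have ht : τ η ∈ Ioo (τ (a / 2)) tb := ⟨hmono ha2 (hsub hη) hη.1, hlt η (hsub hη)⟩
    exact hmono.injOn (hmem _ ht) (hsub hη) (he _ ht).2
  have hemono : StrictMonoOn e (Ioo (τ (a / 2)) tb) := fun s hs t ht hst => by
    rw [← hmono.lt_iff_lt (hmem s hs) (hmem t ht), (he s hs).2, (he t ht).2]
    exact hst
  have hecont : ∀ t ∈ Ioo (τ (a / 2)) tb, ContinuousAt e t := fun t ht => by
    refine hemono.continuousAt_of_image_mem_nhds (isOpen_Ioo.mem_nhds ht) ?_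
    refine mem_of_superset (isOpen_Ioo.mem_nhds (he t ht).1) fun η hη => ?_
    exact ⟨τ η, ⟨hmono ha2 (hsub hη) hη.1, hlt η (hsub hη)⟩, hinv η hη⟩
  have hta : τ (a / 2) < 0 := by
    rw [← hτ0]; exact hmono ha2 h0 (by linarith)
  have htb0 : 0 < tb := by
    rw [← hτ0]; exact hlt 0 h0
  have he0 : e 0 = 0 := by
    have := hinv 0 ⟨by linarith, hb⟩
    rwa [hτ0] at this
  refine ⟨τ (a / 2), tb, e, hta, htb0, he0, fun t ht => ⟨hmem t ht, ?_⟩, ?_, ?_⟩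
  · refine HasDerivAt.of_local_left_inverse (f := τ) (hecont t ht) (hd _ (hmem t ht))
      (hpos _ (hmem t ht)).ne' ?_
    filter_upwards [isOpen_Ioo.mem_nhds ht] with s hs using (he s hs).2
  · intro t ht
    have := hemono.monotoneOn ⟨hta, htb0⟩ ⟨hta.trans_le ht.1, ht.2⟩ ht.1
    rwa [he0] at this
  · rw [tendsto_nhdsWithin_iff]
    have hev : ∀ᶠ t in 𝓝[<] tb, t ∈ Ioo (τ (a / 2)) tb :=
      Ioo_mem_nhdsLT (hta.trans htb0)
    refine ⟨tendsto_order.2 ⟨fun y hy => ?_, fun y hy => ?_⟩, ?_⟩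
    · obtain ⟨η, h1, h2⟩ := exists_between (max_lt hy (show a / 2 < b by linarith))
      have h1' := (le_max_left _ _).trans_lt h1
      have hη : η ∈ Ioo (a / 2) b := ⟨(le_max_right _ _).trans_lt h1, h2⟩
      filter_upwards [hev, Ioo_mem_nhdsLT (hlt η (hsub hη))] with t ht ht'
      refine h1'.trans ?_
      rw [← hmono.lt_iff_lt (hsub hη) (hmem t ht), (he t ht).2]
      exact ht'.1
    · filter_upwards [hev] with t ht using (he t ht).1.2.trans hy
    · filter_upwards [hev] with t ht using (he t ht).1.2

/-! ### Derivatives in stretched time -/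

/-- The `η`-derivative of `denom`. -/
def denomDeriv (h r k : ℝ → ℝ) (η x : ℝ) : ℝ := -h x + r x * k η

/-- The `η`-derivative of `meanInv`. -/
def meanInvDeriv (h r g k : ℝ → ℝ) (η : ℝ) : ℝ :=
  ∫ x in (0 : ℝ)..1, -denomDeriv h r k η x / denom h r g η x ^ 2

/-- The second `η`-derivative of `meanInv`. -/
def meanInvDerivTwo (h r g k : ℝ → ℝ) (η : ℝ) : ℝ :=
  ∫ x in (0 : ℝ)..1, (2 * denomDeriv h r k η x ^ 2 / denom h r g η x ^ 3
    - r x * meanInv h r g η ^ 3 / denom h r g η x ^ 2)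

namespace Amplitude

variable {h r g k h' r' : ℝ → ℝ} {M H : ℝ}

theorem zero_mem (A : Amplitude h r M H g k) : (0 : ℝ) ∈ Ioo (-H⁻¹) M⁻¹ :=
  ⟨by simpa using A.H_pos, inv_pos.2 A.M_pos⟩

theorem denom_pos (A : Amplitude h r M H g k) {η : ℝ} (hη : η ∈ Ioo (-H⁻¹) M⁻¹) (x : ℝ) :
    0 < denom h r g η x := A.pos A.H_pos hη (A.g_nonneg η hη) x

theorem cont_g (A : Amplitude h r M H g k) : ContinuousOn g (Ioo (-H⁻¹) M⁻¹) :=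
  fun η hη => (A.deriv_g η hη).continuousAt.continuousWithinAt

theorem cont_k (A : Amplitude h r M H g k) : ContinuousOn k (Ioo (-H⁻¹) M⁻¹) :=
  fun η hη => (A.deriv_k η hη).continuousAt.continuousWithinAt

theorem cont_denom (A : Amplitude h r M H g k) :
    ContinuousOn (fun p : ℝ × ℝ => denom h r g p.1 p.2) (Ioo (-H⁻¹) M⁻¹ ×ˢ univ) := by
  have h1 : ContinuousOn (fun p : ℝ × ℝ => h p.2) (Ioo (-H⁻¹) M⁻¹ ×ˢ univ) :=
    (A.cont_h.comp continuous_snd).continuousOn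
  have h2 : ContinuousOn (fun p : ℝ × ℝ => r p.2) (Ioo (-H⁻¹) M⁻¹ ×ˢ univ) :=
    (A.cont_r.comp continuous_snd).continuousOn
  have h3 : ContinuousOn (fun p : ℝ × ℝ => g p.1) (Ioo (-H⁻¹) M⁻¹ ×ˢ univ) :=
    A.cont_g.comp continuousOn_fst fun p hp => hp.1
  exact (continuousOn_const.sub (h1.mul continuousOn_fst)).add (h2.mul h3)

theorem cont_denomDeriv (A : Amplitude h r M H g k) :
    ContinuousOn (fun p : ℝ × ℝ => denomDeriv h r k p.1 p.2) (Ioo (-H⁻¹) M⁻¹ ×ˢ univ) := by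
  have h1 : ContinuousOn (fun p : ℝ × ℝ => h p.2) (Ioo (-H⁻¹) M⁻¹ ×ˢ univ) :=
    (A.cont_h.comp continuous_snd).continuousOn
  have h2 : ContinuousOn (fun p : ℝ × ℝ => r p.2) (Ioo (-H⁻¹) M⁻¹ ×ˢ univ) :=
    (A.cont_r.comp continuous_snd).continuousOn
  have h3 : ContinuousOn (fun p : ℝ × ℝ => k p.1) (Ioo (-H⁻¹) M⁻¹ ×ˢ univ) :=
    A.cont_k.comp continuousOn_fst fun p hp => hp.1
  exact h1.neg.add (h2.mul h3)

theorem denom_ne (A : Amplitude h r M H g k) :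
    ∀ p ∈ Ioo (-H⁻¹) M⁻¹ ×ˢ (univ : Set ℝ), denom h r g p.1 p.2 ≠ 0 :=
  fun p hp => (A.denom_pos hp.1 p.2).ne'

theorem hasDerivAt_denom (A : Amplitude h r M H g k) {η : ℝ} (hη : η ∈ Ioo (-H⁻¹) M⁻¹) (x : ℝ) :
    HasDerivAt (fun η => denom h r g η x) (denomDeriv h r k η x) η := by
  refine ((((hasDerivAt_id η).const_mul (h x)).const_sub 1).add
    ((A.deriv_g η hη).const_mul (r x))).congr_deriv ?_
  simp [denomDeriv]

theorem hasDerivAt_denomDeriv (A : Amplitude h r M H g k) {η : ℝ} (hη : η ∈ Ioo (-H⁻¹) M⁻¹)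
    (x : ℝ) : HasDerivAt (fun η => denomDeriv h r k η x) (r x * meanInv h r g η ^ 3) η :=
  ((A.deriv_k η hη).const_mul (r x)).const_add (-h x)

theorem cont_meanInv_density (A : Amplitude h r M H g k) :
    ContinuousOn (uncurry fun η x => (denom h r g η x)⁻¹) (Ioo (-H⁻¹) M⁻¹ ×ˢ univ) :=
  A.cont_denom.inv₀ A.denom_ne

theorem cont_meanInvDeriv_density (A : Amplitude h r M H g k) :
    ContinuousOn (uncurry fun η x => -denomDeriv h r k η x / denom h r g η x ^ 2)
      (Ioo (-H⁻¹) M⁻¹ ×ˢ univ) :=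
  A.cont_denomDeriv.neg.div (A.cont_denom.pow 2) fun p hp => pow_ne_zero 2 (A.denom_ne p hp)

theorem hasDerivAt_meanInv (A : Amplitude h r M H g k) {η : ℝ} (hη : η ∈ Ioo (-H⁻¹) M⁻¹) :
    HasDerivAt (meanInv h r g) (meanInvDeriv h r g k η) η :=
  hasDerivAt_parametric_integral isOpen_Ioo zero_le_one
    (fun _ hs => (continuous_slice A.cont_meanInv_density hs).continuousOn)
    (A.cont_meanInvDeriv_density.mono (prod_mono le_rfl (subset_univ _)))
    (fun _ hs x _ => (A.hasDerivAt_denom hs x).inv (A.denom_pos hs x).ne') hη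

theorem cont_meanInv (A : Amplitude h r M H g k) :
    ContinuousOn (meanInv h r g) (Ioo (-H⁻¹) M⁻¹) :=
  fun _ hη => (A.hasDerivAt_meanInv hη).continuousAt.continuousWithinAt

theorem meanInv_pos (A : Amplitude h r M H g k) {η : ℝ} (hη : η ∈ Ioo (-H⁻¹) M⁻¹) :
    0 < meanInv h r g η :=
  intervalIntegral.integral_pos zero_lt_one
    (continuous_slice A.cont_meanInv_density hη).continuousOn
    (fun x _ => (inv_pos.2 (A.denom_pos hη x)).le)
    ⟨0, by simp, inv_pos.2 (A.denom_pos hη 0)⟩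

theorem cont_meanInvDerivTwo_density (A : Amplitude h r M H g k) :
    ContinuousOn (uncurry fun η x => 2 * denomDeriv h r k η x ^ 2 / denom h r g η x ^ 3
      - r x * meanInv h r g η ^ 3 / denom h r g η x ^ 2) (Ioo (-H⁻¹) M⁻¹ ×ˢ univ) := by
  have h1 : ContinuousOn (fun p : ℝ × ℝ => meanInv h r g p.1) (Ioo (-H⁻¹) M⁻¹ ×ˢ univ) :=
    A.cont_meanInv.comp continuousOn_fst fun p hp => hp.1
  exact ((continuousOn_const.mul (A.cont_denomDeriv.pow 2)).div (A.cont_denom.pow 3)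
    fun p hp => pow_ne_zero 3 (A.denom_ne p hp)).sub
    (((A.cont_r.comp continuous_snd).continuousOn.mul (h1.pow 3)).div (A.cont_denom.pow 2)
    fun p hp => pow_ne_zero 2 (A.denom_ne p hp))

theorem hasDerivAt_meanInvDeriv (A : Amplitude h r M H g k) {η : ℝ}
    (hη : η ∈ Ioo (-H⁻¹) M⁻¹) :
    HasDerivAt (meanInvDeriv h r g k) (meanInvDerivTwo h r g k η) η := by
  refine hasDerivAt_parametric_integral isOpen_Ioo zero_le_one
    (fun _ hs => (continuous_slice A.cont_meanInvDeriv_density hs).continuousOn)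
    (A.cont_meanInvDerivTwo_density.mono (prod_mono le_rfl (subset_univ _)))
    (fun s hs x _ => ?_) hη
  have hne := (A.denom_pos hs x).ne'
  refine ((A.hasDerivAt_denomDeriv hs x).fun_neg.div ((A.hasDerivAt_denom hs x).fun_pow 2)
    (pow_ne_zero 2 hne)).congr_deriv ?_
  push_cast
  field_simp
  ring

theorem cont_meanInvDeriv (A : Amplitude h r M H g k) :
    ContinuousOn (meanInvDeriv h r g k) (Ioo (-H⁻¹) M⁻¹) :=
  fun _ hη => (A.hasDerivAt_meanInvDeriv hη).continuousAt.continuousWithinAt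

theorem cont_meanInvDerivTwo (A : Amplitude h r M H g k) :
    ContinuousOn (meanInvDerivTwo h r g k) (Ioo (-H⁻¹) M⁻¹) :=
  continuousOn_parametric_integral zero_le_one
    (A.cont_meanInvDerivTwo_density.mono (prod_mono le_rfl (subset_univ _)))

theorem denom_zero (A : Amplitude h r M H g k) (x : ℝ) : denom h r g 0 x = 1 := by
  simp [denom, A.g_zero]

theorem meanInv_zero (A : Amplitude h r M H g k) : meanInv h r g 0 = 1 := by
  simp [meanInv, A.denom_zero]

theorem denomDeriv_zero (A : Amplitude h r M H g k) (x : ℝ) : denomDeriv h r k 0 x = -h x := by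
  simp [denomDeriv, A.k_zero]

theorem meanInvDeriv_zero (A : Amplitude h r M H g k) :
    meanInvDeriv h r g k 0 = ∫ x in (0 : ℝ)..1, h x := by
  simp [meanInvDeriv, A.denom_zero, A.denomDeriv_zero]

end Amplitude

/-! ### From the amplitude to the Lagrangian flow -/

/-- The reciprocal Jacobian of the flow in physical time; `e` is the time change. -/
def invJac (h r g e : ℝ → ℝ) (t x : ℝ) : ℝ := meanInv h r g (e t) * denom h r g (e t) x

/-- The time derivative of `invJac`. -/
def invJacTime (h r g k e : ℝ → ℝ) (t x : ℝ) : ℝ :=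
  (meanInvDeriv h r g k (e t) * denom h r g (e t) x
    + meanInv h r g (e t) * denomDeriv h r k (e t) x) / meanInv h r g (e t) ^ 2

/-- The space derivative of `invJac`. -/
def invJacSpace (h' r' h r g e : ℝ → ℝ) (t x : ℝ) : ℝ :=
  meanInv h r g (e t) * (-h' x * e t + r' x * g (e t))

/-- The mixed derivative of `invJac`. -/
def invJacMixed (h' r' h r g k e : ℝ → ℝ) (t x : ℝ) : ℝ :=
  (meanInvDeriv h r g k (e t) * (-h' x * e t + r' x * g (e t))
    + meanInv h r g (e t) * (-h' x + r' x * k (e t))) / meanInv h r g (e t) ^ 2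

/-- The coefficient of the linear Lagrangian equation. -/
def lagrangianCoeff (h r g k e : ℝ → ℝ) (t : ℝ) : ℝ :=
  2 * meanInvDeriv h r g k (e t) ^ 2 / meanInv h r g (e t) ^ 6
    - meanInvDerivTwo h r g k (e t) / meanInv h r g (e t) ^ 5

/-- With w = Pφ and dη/dt = P⁻², the terms in φ_η cancel in w_tt, leaving φ_ηη/P³ = r plus a
multiple of w; that multiple defines `lagrangianCoeff`. The mean condition is the definition of P,
and `hmean` removes P'(0) = ∫ h from the initial value of w_t. -/
theorem Amplitude.lagrangianFlow {h r g k h' r' e : ℝ → ℝ} {M H ta tb : ℝ}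
    (A : Amplitude h r M H g k) (hta : ta < 0) (htb : 0 < tb) (he0 : e 0 = 0)
    (he : ∀ t ∈ Ioo ta tb, e t ∈ Ioo (-H⁻¹) M⁻¹ ∧ HasDerivAt e (meanInv h r g (e t) ^ 2)⁻¹ t)
    (hh : ∀ x ∈ Icc (0 : ℝ) 1, HasDerivWithinAt h (h' x) (Icc 0 1) x)
    (hh' : ContinuousOn h' (Icc 0 1))
    (hr : ∀ x ∈ Icc (0 : ℝ) 1, HasDerivWithinAt r (r' x) (Icc 0 1) x)
    (hr' : ContinuousOn r' (Icc 0 1)) (r0 : r 0 = 0) (r1 : r 1 = 0)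
    (hmean : ∫ x in (0 : ℝ)..1, h x = 0) :
    LagrangianFlow h r r' ta tb (invJac h r g e) (invJacTime h r g k e)
      (invJacSpace h' r' h r g e) (invJacMixed h' r' h r g k e) (lagrangianCoeff h r g k e) := by
  have hec : ContinuousOn e (Ioo ta tb) := fun t ht =>
    (he t ht).2.continuousAt.continuousWithinAt
  have hmaps : MapsTo e (Ioo ta tb) (Ioo (-H⁻¹) M⁻¹) := fun t ht => (he t ht).1
  have hPne : ∀ t ∈ Ioo ta tb, meanInv h r g (e t) ≠ 0 := fun t ht =>
    (A.meanInv_pos (hmaps ht)).ne'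
  have lift1 : ∀ {F : ℝ → ℝ} {U : Set ℝ}, ContinuousOn F (Ioo (-H⁻¹) M⁻¹) →
      ContinuousOn (fun p : ℝ × ℝ => F (e p.1)) (Ioo ta tb ×ˢ U) := fun hF =>
    (hF.comp hec hmaps).comp continuousOn_fst fun p hp => hp.1
  have lift2 : ∀ {F : ℝ → ℝ → ℝ},
      ContinuousOn (fun p : ℝ × ℝ => F p.1 p.2) (Ioo (-H⁻¹) M⁻¹ ×ˢ univ) →
      ContinuousOn (fun p : ℝ × ℝ => F (e p.1) p.2) (Ioo ta tb ×ˢ univ) := fun {F} hF => by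
    have h1 : ContinuousOn (fun p : ℝ × ℝ => (e p.1, p.2)) (Ioo ta tb ×ˢ univ) :=
      (hec.comp continuousOn_fst fun p hp => hp.1).prodMk continuousOn_snd
    exact hF.comp h1 fun p hp => ⟨hmaps hp.1, mem_univ _⟩
  have lift3 : ∀ {F : ℝ → ℝ}, ContinuousOn F (Icc 0 1) →
      ContinuousOn (fun p : ℝ × ℝ => F p.2) (Ioo ta tb ×ˢ Icc 0 1) := fun hF =>
    hF.comp continuousOn_snd fun p hp => hp.2
  have he' : ∀ {U : Set ℝ}, ContinuousOn (fun p : ℝ × ℝ => e p.1) (Ioo ta tb ×ˢ U) :=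
    hec.comp continuousOn_fst fun p hp => hp.1
  have hxd : ∀ t, ∀ x ∈ Icc (0 : ℝ) 1, HasDerivWithinAt (denom h r g (e t))
      (-h' x * e t + r' x * g (e t)) (Icc 0 1) x := fun t x hx => by
    refine ((((hh x hx).mul_const (e t)).const_sub 1).add ((hr x hx).mul_const _)).congr_deriv ?_
    ring
  constructor
  · exact ⟨hta, htb⟩
  · exact A.cont_r
  · exact hr
  · exact hr'
  · exact r0
  · exact r1
  · exact (lift1 A.cont_meanInv).mul (lift2 A.cont_denom)
  · exact (((lift1 A.cont_meanInvDeriv).mul (lift2 A.cont_denom)).add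
      ((lift1 A.cont_meanInv).mul (lift2 A.cont_denomDeriv))).div ((lift1 A.cont_meanInv).pow 2)
      fun p hp => pow_ne_zero 2 (hPne p.1 hp.1)
  · exact (lift1 A.cont_meanInv).mul (((lift3 hh').neg.mul he').add
      ((lift3 hr').mul (lift1 A.cont_g)))
  · exact (((lift1 A.cont_meanInvDeriv).mul (((lift3 hh').neg.mul he').add
      ((lift3 hr').mul (lift1 A.cont_g)))).add ((lift1 A.cont_meanInv).mul
      ((lift3 hh').neg.add ((lift3 hr').mul (lift1 A.cont_k))))).div
      ((lift1 A.cont_meanInv).pow 2) fun p hp => pow_ne_zero 2 (hPne p.1 hp.1)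
  · have c0 := A.cont_meanInv.comp hec hmaps
    have c1 := A.cont_meanInvDeriv.comp hec hmaps
    have c2 := A.cont_meanInvDerivTwo.comp hec hmaps
    exact ((continuousOn_const.mul (c1.pow 2)).div (c0.pow 6)
      fun t ht => pow_ne_zero 6 (hPne t ht)).sub (c2.div (c0.pow 5)
      fun t ht => pow_ne_zero 5 (hPne t ht))
  · exact fun t ht x => mul_pos (A.meanInv_pos (hmaps ht)) (A.denom_pos (hmaps ht) x)
  · intro t ht
    have hH := A.H_pos
    refine ⟨meanInv h r g (e t) * (1 + H * |e t| + H * g (e t)), fun x => ?_⟩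
    refine mul_le_mul_of_nonneg_left ?_ (A.meanInv_pos (hmaps ht)).le
    have h1 : -(h x * e t) ≤ H * |e t| := by
      refine (neg_le_abs _).trans ?_
      rw [abs_mul]
      exact mul_le_mul_of_nonneg_right (A.abs_h_le x) (abs_nonneg _)
    have h2 := mul_le_mul_of_nonneg_right (A.r_le x) (A.g_nonneg _ (hmaps ht))
    unfold denom
    linarith
  · intro t ht x
    have hP := hPne t ht
    have d1 := (A.hasDerivAt_meanInv (hmaps ht)).comp t (he t ht).2
    have d2 := (A.hasDerivAt_denom (hmaps ht) x).comp t (he t ht).2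
    refine (d1.mul d2).congr_deriv ?_
    simp only [invJacTime, comp_apply]
    field_simp
  · intro t ht x
    have hP := hPne t ht
    have d0 := A.hasDerivAt_meanInv (hmaps ht)
    have d1 := A.hasDerivAt_meanInvDeriv (hmaps ht)
    have d2 := A.hasDerivAt_denom (hmaps ht) x
    have d3 := A.hasDerivAt_denomDeriv (hmaps ht) x
    have := ((((d1.fun_mul d2).fun_add (d0.fun_mul d3)).fun_div (d0.fun_pow 2)
      (pow_ne_zero 2 hP)).comp t (he t ht).2)
    refine this.congr_deriv ?_
    simp only [invJac, lagrangianCoeff]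
    push_cast
    field_simp
    ring
  · exact fun t _ x hx => (hxd t x hx).const_mul _
  · intro t _ x hx
    have d3 : HasDerivWithinAt (denomDeriv h r k (e t)) (-h' x + r' x * k (e t)) (Icc 0 1) x :=
      (hh x hx).neg.add ((hr x hx).mul_const _)
    exact (((hxd t x hx).const_mul _).add (d3.const_mul _)).div_const _
  · intro t ht
    simp only [invJac, mul_inv]
    rw [intervalIntegral.integral_const_mul]
    exact inv_mul_cancel₀ (hPne t ht)
  · intro x
    simp [invJac, he0, A.denom_zero, A.meanInv_zero]
  · intro x
    simp [invJacTime, he0, A.denom_zero, A.meanInv_zero, A.denomDeriv_zero, A.meanInvDeriv_zero,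
      hmean]

/-! ### Behaviour as η tends to 1/M: finite duration and collapse of w -/

/-- A nondegenerate boundary maximum is left at least linearly. -/
theorem exists_gap {h h' : ℝ → ℝ} {M : ℝ}
    (hh : ∀ x ∈ Icc (0 : ℝ) 1, HasDerivWithinAt h (h' x) (Icc 0 1) x)
    (hle : ∀ x ∈ Icc (0 : ℝ) 1, h x ≤ M)
    (hb : ∀ x ∈ Icc (0 : ℝ) 1, h x = M → x = 0 ∨ x = 1)
    (hne : ∀ x ∈ Icc (0 : ℝ) 1, h x = M → h' x ≠ 0) :
    ∃ c > 0, ∀ x ∈ Icc (0 : ℝ) 1, c * (x * (1 - x)) ≤ M - h x := by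
  suffices H : ∃ c > 0, ∀ x ∈ Icc (0 : ℝ) 1, x ∈ Icc (0 : ℝ) 1 → c * (x * (1 - x)) ≤ M - h x by
    obtain ⟨c, hc, H⟩ := H
    exact ⟨c, hc, fun x hx => H x hx hx⟩
  -- The estimate is local: by compactness, a positive constant near each point suffices. The
  -- repeated membership in [0,1] makes the property meaningful for arbitrary sets.
  refine isCompact_Icc.induction_on
    (p := fun s => ∃ c > 0, ∀ x ∈ s, x ∈ Icc (0 : ℝ) 1 → c * (x * (1 - x)) ≤ M - h x)
    ⟨1, one_pos, by simp⟩ (fun s t hst => fun ⟨c, hc, H⟩ => ⟨c, hc, fun x hx => H x (hst hx)⟩)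
    ?_ ?_
  · rintro s t ⟨c, hc, H⟩ ⟨d, hd, K⟩
    refine ⟨min c d, lt_min hc hd, fun x hx hx' => ?_⟩
    have h0 : 0 ≤ x * (1 - x) := mul_nonneg hx'.1 (by linarith [hx'.2])
    rcases hx with hx | hx
    · exact (mul_le_mul_of_nonneg_right (min_le_left _ _) h0).trans (H x hx hx')
    · exact (mul_le_mul_of_nonneg_right (min_le_right _ _) h0).trans (K x hx hx')
  · intro y hy
    rcases (hle y hy).lt_or_eq with hlt | heq
    · have hev : ∀ᶠ x in 𝓝[Icc 0 1] y, h x < (M + h y) / 2 :=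
        (hh y hy).continuousWithinAt.eventually_lt_const (by linarith)
      refine ⟨_, hev, (M - h y) / 2, by linarith, fun x hx hx' => ?_⟩
      have h1 : h x < (M + h y) / 2 := hx
      have h2 : x * (1 - x) ≤ 1 := by nlinarith [hx'.1, hx'.2]
      nlinarith
    · have hne' := hne y hy heq
      have hpos : 0 < |h' y| / 2 := by positivity
      -- Near a maximum point y the remainder is at most half of the linear term, so M - h ≥ (|h'
      -- y|/2)|x - y|. As y is an endpoint, |x - y| ≥ x(1-x).
      have hev := Asymptotics.isLittleO_iff.1 (hasDerivWithinAt_iff_isLittleO.1 (hh y hy)) hpos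
      refine ⟨_, hev, |h' y| / 2, hpos, fun x hx hx' => ?_⟩
      have h1 : ‖h x - h y - (x - y) • h' y‖ ≤ |h' y| / 2 * ‖x - y‖ := hx
      rw [heq, smul_eq_mul, Real.norm_eq_abs, Real.norm_eq_abs] at h1
      have h2 : |x - y| * |h' y| ≤ |h x - M - (x - y) * h' y| + |h x - M| := by
        rw [← abs_mul, show (x - y) * h' y = (h x - M) - (h x - M - (x - y) * h' y) by ring]
        refine (abs_sub _ _).trans ?_
        rw [add_comm, show h x - M - (h x - M - (h x - M - (x - y) * h' y))
          = h x - M - (x - y) * h' y by ring]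
      have h3 : |h x - M| = M - h x := by
        rw [abs_sub_comm, abs_of_nonneg]; linarith [hle x hx']
      have h4 : x * (1 - x) ≤ |x - y| := by
        rcases hb y hy heq with rfl | rfl
        · rw [sub_zero, abs_of_nonneg hx'.1]; nlinarith [hx'.1, hx'.2]
        · rw [abs_sub_comm, abs_of_nonneg (by linarith [hx'.2])]; nlinarith [hx'.1, hx'.2]
      nlinarith

theorem rpow_mul_rpow_le_add {u v : ℝ} (hu : 0 ≤ u) (hv : 0 ≤ v) :
    u ^ (1 / 4 : ℝ) * v ^ (3 / 4 : ℝ) ≤ u + v := by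
  have := Real.geom_mean_le_arith_mean2_weighted (w₁ := 1 / 4) (w₂ := 3 / 4) (by norm_num)
    (by norm_num) hu hv (by norm_num)
  linarith

theorem inv_rpow_mul_le {x : ℝ} (hx : x ∈ Ioo (0 : ℝ) 1) :
    ((x * (1 - x)) ^ (3 / 4 : ℝ))⁻¹ ≤ x ^ (-(3 / 4) : ℝ) + (1 - x) ^ (-(3 / 4) : ℝ) := by
  have h1 : 0 < x := hx.1
  have h2 : 0 < 1 - x := by linarith [hx.2]
  have e1 : (x * (1 - x))⁻¹ = x⁻¹ + (1 - x)⁻¹ := by field_simp; ring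
  rw [← Real.inv_rpow (by positivity), e1, Real.rpow_neg h1.le, Real.rpow_neg h2.le,
    ← Real.inv_rpow h1.le, ← Real.inv_rpow h2.le]
  exact Real.rpow_add_le_add_rpow (by positivity) (by positivity) (by norm_num) (by norm_num)

/-- The true growth is logarithmic in ε, but a power is easier to obtain. The weights 1/4 and 3/4
are chosen so that x^(-3/4) is integrable on (0,1) and the square of ε^(-1/4) is integrable in η. -/
theorem integral_inv_add_le {ε : ℝ} (hε : 0 < ε) :
    ∫ x in (0 : ℝ)..1, (ε + x * (1 - x))⁻¹ ≤ (ε ^ (1 / 4 : ℝ))⁻¹ *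
      ∫ x in (0 : ℝ)..1, (x ^ (-(3 / 4) : ℝ) + (1 - x) ^ (-(3 / 4) : ℝ)) := by
  have i1 : IntervalIntegrable (fun x : ℝ => x ^ (-(3 / 4) : ℝ)) volume 0 1 :=
    intervalIntegral.intervalIntegrable_rpow' (by norm_num)
  have i2 : IntervalIntegrable (fun x : ℝ => (1 - x) ^ (-(3 / 4) : ℝ)) volume 0 1 := by
    have := i1.comp_sub_left 1
    simp only [sub_zero, sub_self] at this
    exact this.symm
  rw [← intervalIntegral.integral_const_mul]
  refine intervalIntegral.integral_mono_on_of_le_Ioo zero_le_one ?_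
    ((i1.add i2).const_mul _) fun x hx => ?_
  · refine intervalIntegrable_of_Icc
      (ContinuousOn.inv₀ (by fun_prop) fun x hx => ?_)
    have : 0 ≤ x * (1 - x) := mul_nonneg hx.1 (by linarith [hx.2])
    positivity
  · have h0 : 0 < x * (1 - x) := mul_pos hx.1 (by linarith [hx.2])
    refine le_trans ?_ (mul_le_mul_of_nonneg_left (inv_rpow_mul_le hx) (by positivity))
    rw [← mul_inv]
    exact inv_anti₀ (by positivity) (rpow_mul_rpow_le_add hε.le h0.le)

namespace Amplitude

variable {h r g k : ℝ → ℝ} {M H : ℝ}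

theorem mem_of_Ico (A : Amplitude h r M H g k) {η : ℝ} (hη : η ∈ Ico 0 M⁻¹) :
    η ∈ Ioo (-H⁻¹) M⁻¹ := ⟨A.zero_mem.1.trans_le hη.1, hη.2⟩

theorem eps_pos (A : Amplitude h r M H g k) {η : ℝ} (hη : η < M⁻¹) : 0 < 1 - M * η := by
  have := mul_lt_mul_of_pos_left hη A.M_pos
  rw [mul_inv_cancel₀ A.M_pos.ne'] at this
  linarith

theorem exists_denom_lower_bound (A : Amplitude h r M H g k) {c : ℝ} (hc : 0 < c)
    (hgap : ∀ x ∈ Icc (0 : ℝ) 1, c * (x * (1 - x)) ≤ M - h x) :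
    ∃ d > 0, ∀ η ∈ Ico 0 M⁻¹, ∀ x ∈ Icc (0 : ℝ) 1,
      d * ((1 - M * η) + x * (1 - x)) ≤ denom h r g η x := by
  have hM := A.M_pos
  refine ⟨min (1 / 3) (c / (2 * M)), by positivity, fun η hη x hx => ?_⟩
  have h0 : 0 ≤ x * (1 - x) := mul_nonneg hx.1 (by linarith [hx.2])
  have hε := A.eps_pos hη.2
  have h1 : (1 - M * η) + (M - h x) * η ≤ denom h r g η x := by
    have := mul_nonneg (A.r_nonneg x) (A.g_nonneg η (A.mem_of_Ico hη))
    unfold denom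
    linarith
  have h2 : 0 ≤ (M - h x) * η := mul_nonneg (by linarith [A.h_le x]) hη.1
  refine le_trans ?_ h1
  -- Up to η = 1/(2M) one has 1 - Mη ≥ 1/2 and x(1-x) ≤ 1, whence the constant 1/3. Afterwards the
  -- gap M - h carries a factor η ≥ 1/(2M), whence c/(2M).
  rcases le_total η (1 / (2 * M)) with hs | hs
  · refine (mul_le_mul_of_nonneg_right (min_le_left _ _) (by positivity)).trans ?_
    have h3 : M * η ≤ 1 / 2 := by
      calc M * η ≤ M * (1 / (2 * M)) := by gcongr
        _ = 1 / 2 := by field_simp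
    have h4 : x * (1 - x) ≤ 1 := by nlinarith [hx.1, hx.2]
    linarith
  · have h3 : c / (2 * M) * (x * (1 - x)) ≤ (M - h x) * η := by
      calc c / (2 * M) * (x * (1 - x)) = c * (x * (1 - x)) * (1 / (2 * M)) := by ring
        _ ≤ (M - h x) * η := mul_le_mul (hgap x hx) hs (by positivity) (by linarith [A.h_le x])
    have h5 : min (1 / 3) (c / (2 * M)) * (1 - M * η) ≤ 1 * (1 - M * η) := by
      gcongr
      exact (min_le_left _ _).trans (by norm_num)
    have h6 := mul_le_mul_of_nonneg_right (min_le_right (1 / 3) (c / (2 * M))) h0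
    linarith

theorem exists_meanInv_le (A : Amplitude h r M H g k) {c : ℝ} (hc : 0 < c)
    (hgap : ∀ x ∈ Icc (0 : ℝ) 1, c * (x * (1 - x)) ≤ M - h x) :
    ∃ C, ∀ η ∈ Ico 0 M⁻¹, meanInv h r g η ≤ C * ((1 - M * η) ^ (1 / 4 : ℝ))⁻¹ := by
  obtain ⟨d, hd, hden⟩ := A.exists_denom_lower_bound hc hgap
  refine ⟨d⁻¹ * ∫ x in (0 : ℝ)..1, (x ^ (-(3 / 4) : ℝ) + (1 - x) ^ (-(3 / 4) : ℝ)),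
    fun η hη => ?_⟩
  have hε := A.eps_pos hη.2
  have hpos : ∀ x ∈ Icc (0 : ℝ) 1, 0 < (1 - M * η) + x * (1 - x) := fun x hx => by
    have : 0 ≤ x * (1 - x) := mul_nonneg hx.1 (by linarith [hx.2])
    positivity
  have h1 : meanInv h r g η ≤ ∫ x in (0 : ℝ)..1, d⁻¹ * ((1 - M * η) + x * (1 - x))⁻¹ := by
    refine intervalIntegral.integral_mono_on zero_le_one
      ((continuous_slice A.cont_meanInv_density (A.mem_of_Ico hη)).intervalIntegrable _ _)
      (intervalIntegrable_of_Icc (continuousOn_const.mul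
        (ContinuousOn.inv₀ (by fun_prop) fun x hx => (hpos x hx).ne'))) fun x hx => ?_
    rw [← mul_inv]
    exact inv_anti₀ (mul_pos hd (hpos x hx)) (hden η hη x hx)
  rw [intervalIntegral.integral_const_mul] at h1
  refine h1.trans ?_
  calc _ ≤ d⁻¹ * (((1 - M * η) ^ (1 / 4 : ℝ))⁻¹ *
        ∫ x in (0 : ℝ)..1, (x ^ (-(3 / 4) : ℝ) + (1 - x) ^ (-(3 / 4) : ℝ))) := by
        gcongr
        exact integral_inv_add_le hε
    _ = _ := by ring

/-- The squared bound on P is C²(1 - Mη)^(-1/2), with primitive -(2C²/M)√(1 - Mη); its increment is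
at most 2C²/M. -/
theorem exists_clock_le (A : Amplitude h r M H g k) {C : ℝ}
    (hC : ∀ η ∈ Ico 0 M⁻¹, meanInv h r g η ≤ C * ((1 - M * η) ^ (1 / 4 : ℝ))⁻¹) :
    ∃ B, ∀ η ∈ Ico 0 M⁻¹, ∫ s in (0 : ℝ)..η, meanInv h r g s ^ 2 ≤ B := by
  have hM := A.M_pos
  refine ⟨C ^ 2 * (2 / M), fun η hη => ?_⟩
  have hsub : Icc 0 η ⊆ Ico 0 M⁻¹ := fun s hs => ⟨hs.1, hs.2.trans_lt hη.2⟩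
  have hd : ∀ s ∈ Icc 0 η, HasDerivAt (fun s => -(2 / M) * √(1 - M * s))
      ((√(1 - M * s))⁻¹) s := fun s hs => by
    have hε := A.eps_pos (hsub hs).2
    have h1 := ((((hasDerivAt_id s).const_mul M).const_sub 1).sqrt hε.ne').const_mul (-(2 / M))
    refine h1.congr_deriv ?_
    simp only [id]
    field_simp
  have hcont : ContinuousOn (fun s => (√(1 - M * s))⁻¹) (Icc 0 η) :=
    ContinuousOn.inv₀ (by fun_prop) fun s hs => (Real.sqrt_pos.2 (A.eps_pos (hsub hs).2)).ne'
  have hint : IntervalIntegrable (fun s => (√(1 - M * s))⁻¹) volume 0 η :=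
    ContinuousOn.intervalIntegrable (by rwa [uIcc_of_le hη.1])
  have h1 : ∫ s in (0 : ℝ)..η, meanInv h r g s ^ 2
      ≤ ∫ s in (0 : ℝ)..η, C ^ 2 * (√(1 - M * s))⁻¹ := by
    refine intervalIntegral.integral_mono_on hη.1 (ContinuousOn.intervalIntegrable ?_)
      (hint.const_mul _) fun s hs => ?_
    · rw [uIcc_of_le hη.1]
      exact (A.cont_meanInv.mono fun s hs => A.mem_of_Ico (hsub hs)).pow 2
    · have hε := A.eps_pos (hsub hs).2
      have h2 := pow_le_pow_left₀ (A.meanInv_pos (A.mem_of_Ico (hsub hs))).le (hC s (hsub hs)) 2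
      rw [mul_pow, inv_pow, ← Real.rpow_natCast ((1 - M * s) ^ (1 / 4 : ℝ)),
        ← Real.rpow_mul hε.le] at h2
      rw [Real.sqrt_eq_rpow]
      norm_num at h2 ⊢
      exact h2
  refine h1.trans ?_
  rw [intervalIntegral.integral_const_mul, intervalIntegral.integral_eq_sub_of_hasDerivAt
    (fun s hs => hd s (by rwa [uIcc_of_le hη.1] at hs)) hint]
  gcongr
  have : 0 ≤ 2 / M * √(1 - M * η) := by positivity
  simp
  linarith

/-- The product is the value of w at a boundary maximum. It is positive and at most C(1 - Mη)^(3/4):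
the factor that vanishes beats the growth of the mean. -/
theorem tendsto_meanInv_mul (A : Amplitude h r M H g k) {C : ℝ}
    (hC : ∀ η ∈ Ico 0 M⁻¹, meanInv h r g η ≤ C * ((1 - M * η) ^ (1 / 4 : ℝ))⁻¹) :
    Tendsto (fun η => meanInv h r g η * (1 - M * η)) (𝓝[<] M⁻¹) (𝓝[>] 0) := by
  have hM := A.M_pos
  have hev : ∀ᶠ η in 𝓝[<] M⁻¹, η ∈ Ico 0 M⁻¹ := by
    filter_upwards [Ioo_mem_nhdsLT (inv_pos.2 hM)] with η hη using ⟨hη.1.le, hη.2⟩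
  have hlim : Tendsto (fun η => C * (1 - M * η) ^ (3 / 4 : ℝ)) (𝓝[<] M⁻¹) (𝓝 0) := by
    have h1 : Tendsto (fun η => 1 - M * η) (𝓝[<] M⁻¹) (𝓝 0) := by
      have : ContinuousAt (fun η : ℝ => 1 - M * η) M⁻¹ := by fun_prop
      have h2 := this.tendsto.mono_left (nhdsWithin_le_nhds (s := Iio M⁻¹))
      rwa [mul_inv_cancel₀ hM.ne', sub_self] at h2
    have h3 := (h1.rpow_const (p := 3 / 4) (Or.inr (by norm_num))).const_mul C
    rwa [Real.zero_rpow (by norm_num), mul_zero] at h3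
  refine tendsto_nhdsWithin_iff.2 ⟨?_, ?_⟩
  · refine tendsto_of_tendsto_of_tendsto_of_le_of_le' tendsto_const_nhds hlim ?_ ?_
    · filter_upwards [hev] with η hη
      exact (mul_pos (A.meanInv_pos (A.mem_of_Ico hη)) (A.eps_pos hη.2)).le
    · filter_upwards [hev] with η hη
      have hε := A.eps_pos hη.2
      refine (mul_le_mul_of_nonneg_right (hC η hη) hε.le).trans_eq ?_
      rw [mul_assoc, ← Real.rpow_neg hε.le]
      nth_rewrite 2 [← Real.rpow_one (1 - M * η)]
      rw [← Real.rpow_add hε]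
      norm_num
  · filter_upwards [hev] with η hη
    exact mul_pos (A.meanInv_pos (A.mem_of_Ico hη)) (A.eps_pos hη.2)

end Amplitude

/-! ### Strain and vorticity at the boundary maxima -/

/-- Applied to -f₀' and to ρ₀, this and its counterpart at 1 fix the signs of the two terms in the
numerator of f_xx. -/
theorem deriv_nonneg_of_min_zero {q : ℝ → ℝ} {q' : ℝ} (hq : HasDerivWithinAt q q' (Icc 0 1) 0)
    (h : ∀ x ∈ Icc (0 : ℝ) 1, q 0 ≤ q x) : 0 ≤ q' := by
  have h1 := (hasDerivWithinAt_iff_tendsto_slope' (by simp)).1 (hq.mono Ioo_subset_Icc_self)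
  rw [nhdsWithin_Ioo_eq_nhdsGT zero_lt_one] at h1
  refine ge_of_tendsto h1 ?_
  filter_upwards [Ioo_mem_nhdsGT zero_lt_one] with x hx
  rw [slope_def_field, sub_zero]
  exact div_nonneg (by linarith [h x (Ioo_subset_Icc_self hx)]) hx.1.le

theorem deriv_nonpos_of_min_one {q : ℝ → ℝ} {q' : ℝ} (hq : HasDerivWithinAt q q' (Icc 0 1) 1)
    (h : ∀ x ∈ Icc (0 : ℝ) 1, q 1 ≤ q x) : q' ≤ 0 := by
  have h1 := (hasDerivWithinAt_iff_tendsto_slope' (by simp)).1 (hq.mono Ioo_subset_Icc_self)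
  rw [nhdsWithin_Ioo_eq_nhdsLT zero_lt_one] at h1
  refine le_of_tendsto h1 ?_
  filter_upwards [Ioo_mem_nhdsLT zero_lt_one] with x hx
  rw [slope_def_field]
  exact div_nonpos_of_nonneg_of_nonpos (by linarith [h x (Ioo_subset_Icc_self hx)])
    (by linarith [hx.2])

theorem LagrangianFlow.labelMap_boundary {h r r' : ℝ → ℝ} {a b : ℝ} {w wt wx wtx : ℝ → ℝ → ℝ}
    {c : ℝ → ℝ} (L : LagrangianFlow h r r' a b w wt wx wtx c) {t x : ℝ} (ht : t ∈ Ioo a b)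
    (hx : x = 0 ∨ x = 1) : labelMap w t x = x := by
  rcases hx with rfl | rfl
  · exact L.labelMap_zero ht
  · exact L.labelMap_one ht

/-- The time integral of the strain at a boundary point. -/
theorem LagrangianFlow.integral_dx_boundary {h r r' : ℝ → ℝ} {a b : ℝ}
    {w wt wx wtx : ℝ → ℝ → ℝ} {c : ℝ → ℝ} (L : LagrangianFlow h r r' a b w wt wx wtx c) {t x : ℝ}
    (ht : t ∈ Ico 0 b) (hx : x = 0 ∨ x = 1) :
    ∫ s in (0 : ℝ)..t, dx (velocity w wt s) x = -Real.log (w t x) := by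
  have hsub : Icc 0 t ⊆ Ioo a b := fun s hs =>
    ⟨L.zero_mem.1.trans_le hs.1, hs.2.trans_lt ht.2⟩
  have hxI : x ∈ Icc (0 : ℝ) 1 := by rcases hx with rfl | rfl <;> simp
  have hcong : ∫ s in (0 : ℝ)..t, dx (velocity w wt s) x = ∫ s in (0 : ℝ)..t, -(wt s x / w s x) :=
    intervalIntegral.integral_congr fun s hs => by
      rw [uIcc_of_le ht.1] at hs
      simp only [L.dx_velocity (hsub hs) hxI, strain, L.labelMap_boundary (hsub hs) hx, neg_div]
  have hcs : ∀ {G : ℝ → ℝ → ℝ}, ContinuousOn (uncurry G) (Ioo a b ×ˢ univ) →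
      ContinuousOn (fun s => G s x) (Icc 0 t) := fun hG =>
    hG.comp (f := fun s => (s, x)) (by fun_prop) fun s hs => ⟨hsub hs, mem_univ _⟩
  rw [hcong, intervalIntegral.integral_eq_sub_of_hasDerivAt (f := fun s => -Real.log (w s x))]
  · simp [L.init_w]
  · intro s hs
    rw [uIcc_of_le ht.1] at hs
    exact ((L.deriv_w s (hsub hs) x).log (L.pos s (hsub hs) x).ne').neg
  · refine ContinuousOn.intervalIntegrable ?_
    rw [uIcc_of_le ht.1]
    exact ((hcs L.cont_wt).div (hcs L.cont_w) fun s hs => (L.pos s (hsub hs) x).ne').neg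

section Blowup

variable {h r g k h' r' e : ℝ → ℝ} {M H ta tb : ℝ}

theorem invJac_boundary {t x : ℝ} (hx : h x = M)
    (hr : r x = 0) : invJac h r g e t x = meanInv h r g (e t) * (1 - M * e t) := by
  simp [invJac, denom, hx, hr]

/-- Since `r` vanishes at the endpoint, φ = 1 - Mη and φ_η = -M there. The terms containing the
derivative of the mean cancel, and the coefficients of h' add up to Mη + (1 - Mη) = 1. -/
theorem Amplitude.strainGrad_boundary (A : Amplitude h r M H g k) {c : ℝ → ℝ}
    (L : LagrangianFlow h r r' ta tb (invJac h r g e) (invJacTime h r g k e)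
      (invJacSpace h' r' h r g e) (invJacMixed h' r' h r g k e) c)
    {t x : ℝ} (ht : t ∈ Ioo ta tb) (he : e t ∈ Ioo (-H⁻¹) M⁻¹) (hx : x = 0 ∨ x = 1)
    (hhx : h x = M) (hrx : r x = 0) :
    dx (dx (velocity (invJac h r g e) (invJacTime h r g k e) t)) x
      = (h' x - r' x * (M * g (e t) + (1 - M * e t) * k (e t)))
        * (meanInv h r g (e t) * (1 - M * e t))⁻¹ := by
  have hxI : x ∈ Icc (0 : ℝ) 1 := by rcases hx with rfl | rfl <;> simp
  have hP := (A.meanInv_pos he).ne'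
  have hε := (A.eps_pos he.2).ne'
  rw [L.dx_dx_velocity ht hxI, strainGrad, L.labelMap_boundary ht hx, invJac, invJacTime,
    invJacSpace, invJacMixed, denom, denomDeriv, hhx, hrx]
  simp only [zero_mul, add_zero]
  field_simp
  ring

theorem tendsto_mul_inv_atBot {m b : ℝ → ℝ} {l : Filter ℝ} {q : ℝ} (hq : q < 0)
    (hm : Tendsto m l (𝓝[>] 0)) (hb : ∀ᶠ t in l, b t ≤ q) :
    Tendsto (fun t => b t * (m t)⁻¹) l atBot := by
  have h1 : Tendsto (fun t => (m t)⁻¹) l atTop := tendsto_inv_nhdsGT_zero.comp hm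
  refine tendsto_atBot_mono' l ?_ (h1.const_mul_atTop_of_neg hq)
  filter_upwards [hb, h1.eventually_ge_atTop 0] with t h2 h3
  exact mul_le_mul_of_nonneg_right h2 h3

theorem tendsto_mul_inv_atTop {m b : ℝ → ℝ} {l : Filter ℝ} {q : ℝ} (hq : 0 < q)
    (hm : Tendsto m l (𝓝[>] 0)) (hb : ∀ᶠ t in l, q ≤ b t) :
    Tendsto (fun t => b t * (m t)⁻¹) l atTop := by
  have h1 : Tendsto (fun t => (m t)⁻¹) l atTop := tendsto_inv_nhdsGT_zero.comp hm
  refine tendsto_atTop_mono' l ?_ (h1.const_mul_atTop hq)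
  filter_upwards [hb, h1.eventually_ge_atTop 0] with t h2 h3
  exact mul_le_mul_of_nonneg_right h2 h3

/-- The factor multiplying ρ₀' in f_xx; its sign ensures that the temperature reinforces the blowup.
-/
theorem Amplitude.forcing_nonneg (A : Amplitude h r M H g k) {η : ℝ}
    (hη : η ∈ Ioo (-H⁻¹) M⁻¹) (h0 : 0 ≤ η) : 0 ≤ M * g η + (1 - M * η) * k η :=
  add_nonneg (mul_nonneg A.M_pos.le (A.g_nonneg η hη))
    (mul_nonneg (A.eps_pos hη.2).le (A.k_nonneg η hη h0))

end Blowup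

theorem tendsto_abs_vorticity {f : ℝ → ℝ → ℝ} {x y : ℝ} {l : Filter ℝ} (hy : 0 < y)
    (h : Tendsto (fun t => |dx (dx (f t)) x|) l atTop) :
    Tendsto (fun t => |vorticity f t x y|) l atTop := by
  have : ∀ t, |vorticity f t x y| = y * |dx (dx (f t)) x| := fun t => by
    rw [vorticity, abs_mul, abs_neg, abs_of_pos hy]
  simp only [this]
  exact h.const_mul_atTop hy

/-- A solution cannot be continued beyond a time at which the integrated strain diverges. -/
theorem IsClassicalSolution.lifespan_le {f₀ ρ₀ : ℝ → ℝ} {T tb x : ℝ} {f ρ g σ : ℝ → ℝ → ℝ}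
    (F : IsClassicalSolution f₀ ρ₀ tb f ρ) (G : IsClassicalSolution f₀ ρ₀ T g σ) (htb : 0 < tb)
    (hx : x ∈ Icc (0 : ℝ) 1)
    (h : Tendsto (fun t => ∫ s in (0 : ℝ)..t, dx (f s) x) (𝓝[<] tb) atTop) : T ≤ tb := by
  by_contra hcon
  have hlt : tb < T := not_le.1 hcon
  have G' := G.mono hlt.le
  have hc : ContinuousOn (fun s => dx (g s) x) (Icc 0 tb) :=
    G.continuous_fx.comp (f := fun s => (s, x)) (by fun_prop)
      fun s hs => ⟨⟨hs.1, hs.2.trans_lt hlt⟩, hx⟩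
  obtain ⟨B, hB⟩ := isCompact_Icc.exists_bound_of_continuousOn hc
  have hB0 : 0 ≤ B := (norm_nonneg _).trans (hB 0 ⟨le_rfl, htb.le⟩)
  obtain ⟨t, ht1, ht2⟩ := ((h.eventually_gt_atTop (B * tb)).and (Ioo_mem_nhdsLT htb)).exists
  have hle := intervalIntegral.norm_integral_le_of_norm_le_const (a := 0) (b := t) (C := B)
    (f := fun s => dx (f s) x) fun s hs => by
      rw [uIoc_of_le ht2.1.le] at hs
      have hs' : s ∈ Ico 0 tb := ⟨hs.1.le, hs.2.trans_lt ht2.2⟩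
      -- Up to `tb` the strain is that of the longer solution, which is continuous on the closed
      -- interval [0, tb] and hence bounded.
      rw [dx_congr (fun y hy => (F.unique G' hs' hy).1) hx]
      exact hB s ⟨hs'.1, hs'.2.le⟩
  rw [sub_zero, abs_of_pos ht2.1] at hle
  have h1 : B * t ≤ B * tb := mul_le_mul_of_nonneg_left ht2.2.le hB0
  have h2 := le_abs_self (∫ s in (0 : ℝ)..t, dx (f s) x)
  rw [Real.norm_eq_abs] at hle
  linarith

/-! ### Extension of the data to the line -/

/-- Constant extension of a function on `[0,1]`. -/
def clamp (q : ℝ → ℝ) (x : ℝ) : ℝ := q (projIcc (0 : ℝ) 1 zero_le_one x)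

theorem clamp_eq {q : ℝ → ℝ} {x : ℝ} (hx : x ∈ Icc (0 : ℝ) 1) : clamp q x = q x := by
  rw [clamp, projIcc_of_mem _ hx]

theorem continuous_clamp {q : ℝ → ℝ} (hq : ContinuousOn q (Icc 0 1)) : Continuous (clamp q) :=
  hq.comp_continuous (by fun_prop) fun _ => Subtype.coe_prop _

theorem hasDerivWithinAt_clamp {q : ℝ → ℝ} {q' x : ℝ} (hx : x ∈ Icc (0 : ℝ) 1)
    (hq : HasDerivWithinAt q q' (Icc 0 1) x) : HasDerivWithinAt (clamp q) q' (Icc 0 1) x :=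
  hq.congr (fun _ hy => clamp_eq hy) (clamp_eq hx)

theorem contDiffOn_dx {q : ℝ → ℝ} (hq : ContDiffOn ℝ (⊤ : ℕ∞) q (Icc 0 1)) :
    ContDiffOn ℝ (⊤ : ℕ∞) (dx q) (Icc 0 1) :=
  hq.derivWithin (uniqueDiffOn_Icc zero_lt_one) (by simp)

theorem hasDerivWithinAt_dx {q : ℝ → ℝ} (hq : ContDiffOn ℝ (⊤ : ℕ∞) q (Icc 0 1)) {x : ℝ}
    (hx : x ∈ Icc (0 : ℝ) 1) : HasDerivWithinAt q (dx q x) (Icc 0 1) x :=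
  ((hq.differentiableOn (by simp)) x hx).hasDerivWithinAt

end

end Boussinesq

/-! ### Assembly of the theorem -/

open Boussinesq in
theorem corollary3p3 (f₀ ρ₀ : ℝ → ℝ) (M₀ : ℝ)
    (hf₀ : ContDiffOn ℝ (⊤ : ℕ∞) f₀ (Icc 0 1))
    (hρ₀ : ContDiffOn ℝ (⊤ : ℕ∞) ρ₀ (Icc 0 1))
    (hf₀bc : f₀ 0 = 0 ∧ f₀ 1 = 0)
    (hρ₀bc : ρ₀ 0 = 0 ∧ ρ₀ 1 = 0)
    (hρ₀nonneg : ∀ x ∈ Icc (0 : ℝ) 1, 0 ≤ ρ₀ x)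
    (hM₀ : IsGreatest (Boussinesq.dx f₀ '' Icc 0 1) M₀)
    (hM₀pos : 0 < M₀)
    (hbdry : ∀ x ∈ Icc (0 : ℝ) 1, Boussinesq.dx f₀ x = M₀ → x = 0 ∨ x = 1)
    (hvort : ∀ x ∈ Icc (0 : ℝ) 1, Boussinesq.dx f₀ x = M₀ →
      Boussinesq.dx (Boussinesq.dx f₀) x ≠ 0) :
    ∃ tstar : ℝ, 0 < tstar ∧ ∃ f ρ : ℝ → ℝ → ℝ,
      -- a classical solution on `[0, tstar)`, unique and with maximal lifespan
      Boussinesq.IsClassicalSolution f₀ ρ₀ tstar f ρ ∧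
      (∀ (T : ℝ) (g σ : ℝ → ℝ → ℝ), Boussinesq.IsClassicalSolution f₀ ρ₀ T g σ →
        T ≤ tstar ∧ ∀ t ∈ Ico 0 T, ∀ x ∈ Icc (0 : ℝ) 1, g t x = f t x ∧ σ t x = ρ t x) ∧
      -- blowup at each boundary point where `f₀'` attains its maximum
      (∀ x ∈ Icc (0 : ℝ) 1, Boussinesq.dx f₀ x = M₀ →
        Tendsto (fun t => ∫ s in (0 : ℝ)..t, Boussinesq.dx (f s) x) (𝓝[<] tstar) atTop ∧
        ∀ y : ℝ, 0 < y →
          Tendsto (fun t => |Boussinesq.vorticity f t x y|) (𝓝[<] tstar) atTop) ∧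
      -- two-sided blowup when the maximum is attained at both endpoints
      (Boussinesq.dx f₀ 0 = M₀ → Boussinesq.dx f₀ 1 = M₀ →
        Tendsto (fun t => Boussinesq.dx (Boussinesq.dx (f t)) 0) (𝓝[<] tstar) atBot ∧
        Tendsto (fun t => Boussinesq.dx (Boussinesq.dx (f t)) 1) (𝓝[<] tstar) atTop) := by
  have I0 : (0 : ℝ) ∈ Icc (0 : ℝ) 1 := by simp
  have I1 : (1 : ℝ) ∈ Icc (0 : ℝ) 1 := by simp
  have hle : ∀ x ∈ Icc (0 : ℝ) 1, dx f₀ x ≤ M₀ := fun x hx => hM₀.2 ⟨x, hx, rfl⟩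
  have hdx := contDiffOn_dx hf₀
  have hddx := contDiffOn_dx hdx
  have hdρ := contDiffOn_dx hρ₀
  obtain ⟨B₁, hB₁⟩ := isCompact_Icc.exists_bound_of_continuousOn hdx.continuousOn
  obtain ⟨B₂, hB₂⟩ := isCompact_Icc.exists_bound_of_continuousOn hρ₀.continuousOn
  -- The 1 only makes H positive, so that -1/H is a genuine negative endpoint in stretched time.
  set H := max (max B₁ B₂) 1
  have hH : 0 < H := lt_max_of_lt_right one_pos
  set h := clamp (dx f₀)
  set r := clamp ρ₀
  have hproj : ∀ x, (projIcc (0 : ℝ) 1 zero_le_one x : ℝ) ∈ Icc (0 : ℝ) 1 := fun x =>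
    Subtype.coe_prop _
  have adm : Admissible h r M₀ H :=
    { cont_h := continuous_clamp hdx.continuousOn
      cont_r := continuous_clamp hρ₀.continuousOn
      M_pos := hM₀pos
      h_le := fun x => hle _ (hproj x)
      abs_h_le := fun x => (hB₁ _ (hproj x)).trans ((le_max_left _ _).trans (le_max_left _ _))
      r_nonneg := fun x => hρ₀nonneg _ (hproj x)
      r_le := fun x => (le_abs_self _).trans ((hB₂ _ (hproj x)).trans
        ((le_max_right _ _).trans (le_max_left _ _))) }
  obtain ⟨g, k, A⟩ := adm.exists_amplitude hH
  obtain ⟨c, hc, hgap⟩ := exists_gap (fun x hx => hasDerivWithinAt_dx hdx hx) hle hbdry hvort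
  obtain ⟨C, hC⟩ := A.exists_meanInv_le hc fun x hx => (hgap x hx).trans_eq
    (by rw [show h x = dx f₀ x from clamp_eq hx])
  obtain ⟨B, hB⟩ := A.exists_clock_le hC
  obtain ⟨ta, tb, e, hta, htb, he0, he, hepos, helim⟩ := exists_time_change A.zero_mem.1
    A.zero_mem.2 (A.cont_meanInv.pow 2) (fun η hη => pow_pos (A.meanInv_pos hη) 2) hB
  have hint : ∀ x ∈ Icc (0 : ℝ) 1, f₀ x = ∫ y in (0 : ℝ)..x, h y := fun x hx => by
    have hsub : Icc 0 x ⊆ Icc (0 : ℝ) 1 := Icc_subset_Icc_right hx.2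
    rw [intervalIntegral.integral_eq_sub_of_hasDerivAt_of_le (f := f₀) hx.1
      (hf₀.continuousOn.mono hsub) (fun y hy => ?_) (adm.cont_h.intervalIntegrable _ _),
      hf₀bc.1, sub_zero]
    have hy' := hsub (Ioo_subset_Icc_self hy)
    rw [show h y = dx f₀ y from clamp_eq hy']
    exact (hasDerivWithinAt_dx hf₀ hy').hasDerivAt (Icc_mem_nhds hy.1 (hy.2.trans_le hx.2))
  have r0 : r 0 = 0 := (clamp_eq I0).trans hρ₀bc.1
  have r1 : r 1 = 0 := (clamp_eq I1).trans hρ₀bc.2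
  have L := A.lagrangianFlow hta htb he0 he
    (fun x hx => hasDerivWithinAt_clamp hx (hasDerivWithinAt_dx hdx hx)) hddx.continuousOn
    (fun x hx => hasDerivWithinAt_clamp hx (hasDerivWithinAt_dx hρ₀ hx)) hdρ.continuousOn
    r0 r1 ((hint 1 I1).symm.trans hf₀bc.2)
  have sol := L.isClassicalSolution hint fun x hx => (clamp_eq hx).symm
  have hev : ∀ᶠ t in 𝓝[<] tb, t ∈ Ioo 0 tb := Ioo_mem_nhdsLT htb
  have hsub : Ioo 0 tb ⊆ Ioo ta tb := Ioo_subset_Ioo_left hta.le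
  have hm : Tendsto (fun t => meanInv h r g (e t) * (1 - M₀ * e t)) (𝓝[<] tb) (𝓝[>] 0) :=
    (A.tendsto_meanInv_mul hC).comp helim
  have hr0 : ∀ x, x = 0 ∨ x = 1 → r x = 0 := fun x hx => by
    rcases hx with rfl | rfl <;> assumption
  have hforce : ∀ᶠ t in 𝓝[<] tb, 0 ≤ M₀ * g (e t) + (1 - M₀ * e t) * k (e t) := by
    filter_upwards [hev] with t ht
    exact A.forcing_nonneg (he t (hsub ht)).1 (hepos t ⟨ht.1.le, ht.2⟩)
  have hlog : ∀ x ∈ Icc (0 : ℝ) 1, dx f₀ x = M₀ → Tendsto (fun t => ∫ s in (0 : ℝ)..t,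
      dx (velocity (invJac h r g e) (invJacTime h r g k e) s) x) (𝓝[<] tb) atTop := by
    intro x hx hxM
    have hxb := hbdry x hx hxM
    have h1 : Tendsto (fun t => -Real.log (meanInv h r g (e t) * (1 - M₀ * e t))) (𝓝[<] tb)
        atTop := tendsto_neg_atBot_atTop.comp (Real.tendsto_log_nhdsGT_zero.comp hm)
    refine h1.congr' ?_
    filter_upwards [hev] with t ht
    rw [L.integral_dx_boundary ⟨ht.1.le, ht.2⟩ hxb,
      invJac_boundary ((clamp_eq hx).trans hxM) (hr0 x hxb)]
  have hgrad : ∀ x ∈ Icc (0 : ℝ) 1, dx f₀ x = M₀ → ∀ᶠ t in 𝓝[<] tb,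
      (dx (dx f₀) x - dx ρ₀ x * (M₀ * g (e t) + (1 - M₀ * e t) * k (e t)))
        * (meanInv h r g (e t) * (1 - M₀ * e t))⁻¹
      = dx (dx (velocity (invJac h r g e) (invJacTime h r g k e) t)) x := by
    intro x hx hxM
    have hxb := hbdry x hx hxM
    filter_upwards [hev] with t ht
    exact (A.strainGrad_boundary L (hsub ht) (he t (hsub ht)).1 hxb
      ((clamp_eq hx).trans hxM) (hr0 x hxb)).symm
  have hzero : dx f₀ 0 = M₀ → Tendsto (fun t =>
      dx (dx (velocity (invJac h r g e) (invJacTime h r g k e) t)) 0) (𝓝[<] tb) atBot := by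
    intro h0
    -- Maximality gives f₀''(0) ≤ 0 and nondegeneracy makes it strict; ρ₀ ≥ 0 = ρ₀(0) gives ρ₀'(0) ≥
    -- 0. The numerator thus stays below the fixed negative number f₀''(0).
    have d1 : 0 ≤ -dx (dx f₀) 0 := deriv_nonneg_of_min_zero (hasDerivWithinAt_dx hdx I0).neg
      fun x hx => by simpa [h0] using hle x hx
    have d2 : 0 ≤ dx ρ₀ 0 := deriv_nonneg_of_min_zero (hasDerivWithinAt_dx hρ₀ I0)
      fun x hx => by simpa [hρ₀bc.1] using hρ₀nonneg x hx
    have d3 : dx (dx f₀) 0 < 0 := lt_of_le_of_ne (by linarith) (hvort 0 I0 h0)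
    refine (tendsto_mul_inv_atBot d3 hm ?_).congr' (hgrad 0 I0 h0)
    filter_upwards [hforce] with t ht
    linarith [mul_nonneg d2 ht]
  have hone : dx f₀ 1 = M₀ → Tendsto (fun t =>
      dx (dx (velocity (invJac h r g e) (invJacTime h r g k e) t)) 1) (𝓝[<] tb) atTop := by
    intro h1
    have d1 : -dx (dx f₀) 1 ≤ 0 := deriv_nonpos_of_min_one (hasDerivWithinAt_dx hdx I1).neg
      fun x hx => by simpa [h1] using hle x hx
    have d2 : dx ρ₀ 1 ≤ 0 := deriv_nonpos_of_min_one (hasDerivWithinAt_dx hρ₀ I1)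
      fun x hx => by simpa [hρ₀bc.2] using hρ₀nonneg x hx
    have d3 : 0 < dx (dx f₀) 1 := lt_of_le_of_ne (by linarith) (hvort 1 I1 h1).symm
    refine (tendsto_mul_inv_atTop d3 hm ?_).congr' (hgrad 1 I1 h1)
    filter_upwards [hforce] with t ht
    linarith [mul_nonpos_of_nonpos_of_nonneg d2 ht]
  refine ⟨tb, htb, _, _, sol, fun T g' σ' hT => ?_, fun x hx hxM => ⟨hlog x hx hxM,
    fun y hy => tendsto_abs_vorticity hy ?_⟩, fun h0 h1 => ⟨hzero h0, hone h1⟩⟩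
  -- The maximum is attained, so some boundary point has divergent integrated strain, which bounds
  -- every lifespan by `tb`.
  · obtain ⟨x, hx, hxM⟩ := hM₀.1
    have hTle := sol.lifespan_le hT htb hx (hlog x hx hxM)
    exact ⟨hTle, fun t ht y hy => hT.unique (sol.mono hTle) ht hy⟩
  · rcases hbdry x hx hxM with rfl | rfl
    · exact tendsto_abs_atBot_atTop.comp (hzero hxM)
    · exact tendsto_abs_atTop_atTop.comp (hone hxM)
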